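/- Let $d\in\mathbb N_0$ and $\sigma>1$. For $\tau>0$ put $M_0^{\tau,\sigma}=1$ and $M_p^{\tau,\sigma}=p^{\tau p^\sigma}$ for $p\ge 1$. Let $\mathcal E_{(\tau,\sigma)}(\mathbb R^d)$ be the space of all $\varphi\in C^\infty(\mathbb R^d)$ (complex valued) such that for every compact $K\subset\mathbb R^d$ and every $\eta>0$ there is $C_{K,\eta}>0$ with $|\partial^\alpha\varphi(x)|\le C_{K,\eta}\,\eta^{|\alpha|^\sigma}M_{|\alpha|}^{\tau,\sigma}$ for all $x\in K$ and $\alpha\in\mathbb N_0^d$, and let $\mathcal E_{(\sigma)}(\mathbb R^d)=\bigcap_{\tau>0}\mathcal E_{(\tau,\sigma)}(\mathbb R^d)$. Let $\mathcal E'_{(\sigma)}(\mathbb R^d)$ be the space of all linear functionals $u:\mathcal E_{(\sigma)}(\mathbb R^d)\to\mathbb C$ for which there are $\tau,\varepsilon,C>0$ and a compact set $K\subset\mathbb R^d$ with $$|(u,\varphi)|\le C\sup_{\alpha\in\mathbb N_0^d,\ x\in K}\frac{|D^\alpha\varphi(x)|}{\varepsilon^{|\alpha|^\sigma}M_{|\alpha|}^{\tau,\sigma}}\qquad\text{for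 all }\varphi\in\mathcal E_{(\sigma)}(\mathbb R^d),$$ where $D_j=-\frac{1}{2\pi i}\partial_j$. The Fourier transform of such a $u$ is the function $\widehat u(\xi)=(u,e^{-2\pi i\langle\cdot,\xi\rangle})$, $\xi\in\mathbb R^d$. Let $W:[0,\infty)\to[0,\infty)$ be the Lambert function, i.e. the inverse of $w\mapsto we^w$ on $[0,\infty)$. (i) If $u\in\mathcal E'_{(\sigma)}(\mathbb R^d)$, then there exist constants $h,C>0$ such that $$|\widehat u(\xi)|\le C\exp\left\{h\left(\frac{\ln^\sigma|\xi|}{W(\ln|\xi|)}\right)^{\frac1{\sigma-1}}\right\}\qquad\text{for }|\xi|\text{ large enough}.$$ (ii) If $u\in\mathcal E'_{(\sigma)}(\mathbb R^d)$ and if for every $h>0$ there exists $C>0$ such that $$|\widehat u(\xi)|\le C\exp\left\{-h\left(\frac{\ln^\sigma|\xi|}{W(\ln|\xi|)}\right)^{\frac1{\sigma-1}}\right\}\qquad\text{for }|\xi|\text{ large enough}$$ (where how large may depend on $h$), then $u\in\mathcal E_{(\sigma)}(\mathbb R^d)$, that is, there is $f\in\mathcal E_{(\sigma)}(\mathbb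 R^d)$ such that for all $\varphi\in\mathcal E_{(\sigma)}(\mathbb R^d)$ the product $f\varphi$ is integrable and $(u,\varphi)=\int_{\mathbb R^d}f(x)\varphi(x)\,dx$. -/

import Mathlib

open scoped ContDiff

noncomputable section

namespace ExtGevrey

/-- The Lambert function on `[0, ∞)`: the inverse of `w ↦ w * exp w` on `[0, ∞)`. -/
def lambertW (x : ℝ) : ℝ :=
  Function.invFunOn (fun w : ℝ => w * Real.exp w) (Set.Ici 0) x

/-- The choice made in `lambertW` is a genuine one on `[0, ∞)`. -/
theorem lambertW_spec {x : ℝ} (hx : 0 ≤ x) :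
    0 ≤ lambertW x ∧ lambertW x * Real.exp (lambertW x) = x := by
  have hc : ContinuousOn (fun w : ℝ => w * Real.exp w) (Set.Icc 0 x) := by fun_prop
  have hmem : x ∈ Set.Icc ((fun w : ℝ => w * Real.exp w) 0) ((fun w : ℝ => w * Real.exp w) x) := by
    constructor
    · simpa using hx
    · have h1 : 1 ≤ Real.exp x := Real.one_le_exp hx
      nlinarith
  obtain ⟨w, hw, hwx⟩ := intermediate_value_Icc hx hc hmem
  have hex : ∃ a ∈ Set.Ici (0 : ℝ), (fun w : ℝ => w * Real.exp w) a = x := ⟨w, hw.1, hwx⟩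
  exact ⟨Function.invFunOn_mem hex, Function.invFunOn_eq hex⟩

/-- The length `|α| = α₁ + ⋯ + α_d` of a multi-index. -/
def len {d : ℕ} (α : Fin d → ℕ) : ℕ := ∑ i, α i

/-- The partial derivative `∂^α φ (x)`: the derivative of order `|α|` of `φ` at `x`, evaluated at
the tuple `(e₁, …, e₁, e₂, …, e₂, …, e_d, …, e_d)` in which `e_i` occurs `α_i` times. -/
def partialD {d : ℕ} (α : Fin d → ℕ) (φ : EuclideanSpace ℝ (Fin d) → ℂ)
    (x : EuclideanSpace ℝ (Fin d)) : ℂ :=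
  iteratedFDeriv ℝ (len α) φ x
    (fun j => EuclideanSpace.single (finSigmaFinEquiv.symm j).1 (1 : ℝ))

/-- `D^α φ (x)`, where `D_j = - (1 / (2 π i)) ∂_j`. -/
def diffD {d : ℕ} (α : Fin d → ℕ) (φ : EuclideanSpace ℝ (Fin d) → ℂ)
    (x : EuclideanSpace ℝ (Fin d)) : ℂ :=
  (-1 / (2 * Real.pi * Complex.I)) ^ len α * partialD α φ x

/-- The defining sequence `M_p = p ^ (τ p ^ σ)`; for `σ ≠ 0` it has `M_0 = 0 ^ 0 = 1`. -/
def M (τ σ : ℝ) (p : ℕ) : ℝ := (p : ℝ) ^ (τ * (p : ℝ) ^ σ)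

/-- The extended Gevrey class `E_(τ,σ)(ℝ^d)` of Beurling type. -/
def classE (d : ℕ) (τ σ : ℝ) : Submodule ℂ (EuclideanSpace ℝ (Fin d) → ℂ) where
  carrier := {φ | ContDiff ℝ ∞ φ ∧
    ∀ K : Set (EuclideanSpace ℝ (Fin d)), IsCompact K → ∀ h : ℝ, 0 < h → ∃ C : ℝ, 0 < C ∧
      ∀ x ∈ K, ∀ α : Fin d → ℕ,
        ‖partialD α φ x‖ ≤ C * h ^ ((len α : ℝ) ^ σ) * M τ σ (len α)}
  add_mem' := by
    rintro f g ⟨hf, hf'⟩ ⟨hg, hg'⟩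
    refine ⟨hf.add hg, fun K hK h hh => ?_⟩
    obtain ⟨C₁, hC₁, h₁⟩ := hf' K hK h hh
    obtain ⟨C₂, hC₂, h₂⟩ := hg' K hK h hh
    refine ⟨C₁ + C₂, by positivity, fun x hx α => ?_⟩
    have e : partialD α (f + g) x = partialD α f x + partialD α g x := by
      unfold partialD
      rw [iteratedFDeriv_add_apply (hf.of_le (by exact_mod_cast le_top)).contDiffAt
        (hg.of_le (by exact_mod_cast le_top)).contDiffAt]
      rfl
    rw [e, add_mul, add_mul]
    exact (norm_add_le _ _).trans (add_le_add (h₁ x hx α) (h₂ x hx α))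
  zero_mem' := by
    refine ⟨contDiff_const, fun K _ h hh => ⟨1, one_pos, fun x _ α => ?_⟩⟩
    have e : partialD α (0 : EuclideanSpace ℝ (Fin d) → ℂ) x = 0 := by
      unfold partialD
      rw [show (0 : EuclideanSpace ℝ (Fin d) → ℂ) = fun _ => 0 from rfl, iteratedFDeriv_fun_zero]
      rfl
    rw [e, norm_zero]
    unfold M
    positivity
  smul_mem' := by
    rintro c f ⟨hf, hf'⟩
    refine ⟨contDiff_const.smul hf, fun K hK h hh => ?_⟩
    obtain ⟨C, hC, h₁⟩ := hf' K hK h hh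
    refine ⟨(‖c‖ + 1) * C, by positivity, fun x hx α => ?_⟩
    have e : partialD α (c • f) x = c * partialD α f x := by
      unfold partialD
      rw [iteratedFDeriv_const_smul_apply (hf.of_le (by exact_mod_cast le_top)).contDiffAt]
      rfl
    rw [e, norm_mul, mul_assoc, mul_assoc]
    have h2 := h₁ x hx α
    rw [mul_assoc] at h2
    have h3 := norm_nonneg (partialD α f x)
    exact mul_le_mul (by linarith) h2 h3 (by positivity)

/-- `E_(σ)(ℝ^d)`, the intersection of the classes `E_(τ,σ)(ℝ^d)` over all `τ > 0`. -/
def testE (d : ℕ) (σ : ℝ) : Submodule ℂ (EuclideanSpace ℝ (Fin d) → ℂ) :=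
  ⨅ (τ : ℝ) (_ : 0 < τ), classE d τ σ

/-- `u ∈ E'_(σ)(ℝ^d)`: the linear functional `u` on `E_(σ)(ℝ^d)` is continuous, that is, bounded by
one of the seminorms of some `E_(τ,σ)(ℝ^d)`. The supremum is finite for each `φ` in `E_(σ)(ℝ^d)`,
see `bddAbove_of_mem_testE`. -/
def IsUltradistribution {d : ℕ} {σ : ℝ} (u : testE d σ →ₗ[ℂ] ℂ) : Prop :=
  ∃ τ : ℝ, 0 < τ ∧ ∃ K : Set (EuclideanSpace ℝ (Fin d)), IsCompact K ∧
    ∃ ε : ℝ, 0 < ε ∧ ∃ C : ℝ, 0 < C ∧ ∀ φ : testE d σ,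
      ‖u φ‖ ≤ C * ⨆ p : (Fin d → ℕ) × K,
        ‖diffD p.1 (φ : EuclideanSpace ℝ (Fin d) → ℂ) p.2‖ /
          (ε ^ ((len p.1 : ℝ) ^ σ) * M τ σ (len p.1))

theorem norm_diffD_le {d : ℕ} (α : Fin d → ℕ) (φ : EuclideanSpace ℝ (Fin d) → ℂ)
    (x : EuclideanSpace ℝ (Fin d)) : ‖diffD α φ x‖ ≤ ‖partialD α φ x‖ := by
  unfold diffD
  rw [norm_mul, norm_pow]
  refine mul_le_of_le_one_left (norm_nonneg _) (pow_le_one₀ (norm_nonneg _) ?_)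
  have : (1 : ℝ) ≤ 2 * Real.pi := by linarith [Real.pi_gt_three]
  simp only [norm_div, norm_neg, norm_one, norm_mul, Complex.norm_I, mul_one, Complex.norm_real,
    Complex.norm_ofNat, Real.norm_eq_abs, abs_of_pos Real.pi_pos]
  rw [div_le_one (by linarith)]
  exact this

theorem M_pos {τ σ : ℝ} (hσ : 1 < σ) (p : ℕ) : 0 < M τ σ p := by
  unfold M
  rcases Nat.eq_zero_or_pos p with rfl | hp
  · simp [Real.zero_rpow (by linarith : σ ≠ 0)]
  · positivity

theorem bddAbove_of_mem_testE {d : ℕ} {σ : ℝ} (hσ : 1 < σ) (φ : testE d σ) {τ : ℝ} (hτ : 0 < τ)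
    {K : Set (EuclideanSpace ℝ (Fin d))} (hK : IsCompact K) {ε : ℝ} (hε : 0 < ε) :
    BddAbove (Set.range fun p : (Fin d → ℕ) × K =>
      ‖diffD p.1 (φ : EuclideanSpace ℝ (Fin d) → ℂ) p.2‖ /
          (ε ^ ((len p.1 : ℝ) ^ σ) * M τ σ (len p.1))) := by
  have h := φ.2
  simp only [testE, Submodule.mem_iInf] at h
  obtain ⟨C, -, hC⟩ := (h τ hτ).2 K hK ε hε
  refine ⟨C, ?_⟩
  rintro _ ⟨⟨α, x, hx⟩, rfl⟩
  have hM : 0 < M τ σ (len α) := M_pos hσ _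
  simp only
  rw [div_le_iff₀ (by positivity), ← mul_assoc]
  exact (norm_diffD_le α _ x).trans (hC x hx α)

/-- The exponential `x ↦ exp (-2 π i x · ξ)`. -/
def expo {d : ℕ} (ξ : EuclideanSpace ℝ (Fin d)) (x : EuclideanSpace ℝ (Fin d)) : ℂ :=
  Complex.exp (-(2 * Real.pi * Complex.I * (inner ℝ x ξ : ℝ)))

theorem norm_expo {d : ℕ} (ξ x : EuclideanSpace ℝ (Fin d)) : ‖expo ξ x‖ = 1 := by
  unfold expo
  rw [show (-(2 * Real.pi * Complex.I * (inner ℝ x ξ : ℝ)) : ℂ)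
    = ((-(2 * Real.pi * inner ℝ x ξ) : ℝ) : ℂ) * Complex.I by push_cast; ring]
  exact Complex.norm_exp_ofReal_mul_I _

theorem contDiff_expo {d : ℕ} (ξ : EuclideanSpace ℝ (Fin d)) : ContDiff ℝ ∞ (expo ξ) := by
  unfold expo
  have h : ContDiff ℝ ∞ fun x : EuclideanSpace ℝ (Fin d) => ((inner ℝ x ξ : ℝ) : ℂ) :=
    Complex.ofRealCLM.contDiff.comp (contDiff_id.inner ℝ contDiff_const)
  exact ((contDiff_const.mul h).neg).cexp

theorem norm_iteratedFDeriv_expo_le {d : ℕ} (ξ : EuclideanSpace ℝ (Fin d)) :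
    ∃ A : ℝ, 1 ≤ A ∧ ∀ (n : ℕ) (x : EuclideanSpace ℝ (Fin d)),
      ‖iteratedFDeriv ℝ n (expo ξ) x‖ ≤ A ^ n := by
  let L : EuclideanSpace ℝ (Fin d) →L[ℝ] ℂ :=
    (-(2 * Real.pi * Complex.I) : ℂ) • (Complex.ofRealCLM.comp ((innerSL ℝ) ξ))
  have hL : ∀ x, expo ξ x = Complex.exp (L x) := by
    intro x
    simp [expo, L, real_inner_comm]
  let T : ℂ →L[ℝ] (EuclideanSpace ℝ (Fin d) →L[ℝ] ℂ) :=
    (ContinuousLinearMap.lsmul ℝ ℂ (E := EuclideanSpace ℝ (Fin d) →L[ℝ] ℂ)).flip L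
  have hder : fderiv ℝ (expo ξ) = T ∘ expo ξ := by
    funext x
    have h : HasFDerivAt (fun x => Complex.exp (L x)) (Complex.exp (L x) • L) x :=
      L.hasFDerivAt.cexp
    rw [show expo ξ = fun x => Complex.exp (L x) from funext hL, h.fderiv]
    rfl
  refine ⟨max 1 ‖T‖, le_max_left _ _, fun n => ?_⟩
  induction n with
  | zero => intro x; simp [norm_expo]
  | succ n ih =>
    intro x
    rw [← norm_iteratedFDeriv_fderiv, hder]
    refine (T.norm_iteratedFDeriv_comp_left (contDiff_expo ξ).contDiffAt
      (by exact_mod_cast le_top)).trans ?_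
    rw [pow_succ']
    exact mul_le_mul (le_max_right _ _) (ih x) (norm_nonneg _) (by positivity)

theorem pow_le_M {A τ σ h : ℝ} (hA : 1 ≤ A) (hτ : 0 < τ) (hσ : 1 < σ) (hh : 0 < h) :
    ∃ C : ℝ, 0 < C ∧ ∀ n : ℕ, A ^ n ≤ C * h ^ ((n : ℝ) ^ σ) * M τ σ n := by
  have hlim : Filter.Tendsto (fun n : ℕ => h * (n : ℝ) ^ τ) Filter.atTop Filter.atTop :=
    ((tendsto_rpow_atTop hτ).comp tendsto_natCast_atTop_atTop).const_mul_atTop hh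
  obtain ⟨N, hN⟩ := Filter.eventually_atTop.1 (hlim.eventually_ge_atTop A)
  have hpos : ∀ n : ℕ, 0 < h ^ ((n : ℝ) ^ σ) * M τ σ n := fun n =>
    mul_pos (by positivity) (M_pos hσ n)
  refine ⟨1 + ∑ n ∈ Finset.range N, A ^ n / (h ^ ((n : ℝ) ^ σ) * M τ σ n), ?_, fun n => ?_⟩
  · have : 0 ≤ ∑ n ∈ Finset.range N, A ^ n / (h ^ ((n : ℝ) ^ σ) * M τ σ n) :=
      Finset.sum_nonneg fun n _ => div_nonneg (by positivity) (hpos n).le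
    linarith
  · rw [mul_assoc, ← div_le_iff₀ (hpos n)]
    rcases lt_or_ge n N with hn | hn
    · have := Finset.single_le_sum
        (f := fun n : ℕ => A ^ n / (h ^ ((n : ℝ) ^ σ) * M τ σ n))
        (fun n _ => div_nonneg (by positivity) (hpos n).le) (Finset.mem_range.2 hn)
      linarith
    · have h0 : 0 ≤ ∑ n ∈ Finset.range N, A ^ n / (h ^ ((n : ℝ) ^ σ) * M τ σ n) :=
        Finset.sum_nonneg fun n _ => div_nonneg (by positivity) (hpos n).le
      refine le_trans ?_ (le_add_of_nonneg_right h0)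
      rw [div_le_one (hpos n)]
      have e : h ^ ((n : ℝ) ^ σ) * M τ σ n = (h * (n : ℝ) ^ τ) ^ ((n : ℝ) ^ σ) := by
        rw [Real.mul_rpow hh.le (by positivity), M, Real.rpow_mul (by positivity)]
      rw [e, ← Real.rpow_natCast]
      have h1 : A ^ ((n : ℝ) ^ σ) ≤ (h * (n : ℝ) ^ τ) ^ ((n : ℝ) ^ σ) :=
        Real.rpow_le_rpow (by linarith) (hN n hn) (by positivity)
      refine le_trans (Real.rpow_le_rpow_of_exponent_le hA ?_) h1
      rcases Nat.eq_zero_or_pos n with rfl | hn0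
      · simp [Real.zero_rpow (by linarith : σ ≠ 0)]
      · have : (1 : ℝ) ≤ n := by exact_mod_cast hn0
        simpa using Real.rpow_le_rpow_of_exponent_le this hσ.le

theorem expo_mem_testE {d : ℕ} {σ : ℝ} (hσ : 1 < σ) (ξ : EuclideanSpace ℝ (Fin d)) :
    expo ξ ∈ testE d σ := by
  simp only [testE, Submodule.mem_iInf]
  intro τ hτ
  refine ⟨contDiff_expo ξ, fun K _ h hh => ?_⟩
  obtain ⟨A, hA, hbound⟩ := norm_iteratedFDeriv_expo_le ξ
  obtain ⟨C, hC, hle⟩ := pow_le_M hA hτ hσ hh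
  refine ⟨C, hC, fun x _ α => le_trans ?_ ((hbound (len α) x).trans (hle (len α)))⟩
  unfold partialD
  refine (ContinuousMultilinearMap.le_opNorm _ _).trans ?_
  simp

/-- The Fourier transform `û(ξ) = (u, exp (-2 π i ⟨·, ξ⟩))` of a compactly supported
ultradistribution. -/
def fourier {d : ℕ} {σ : ℝ} (hσ : 1 < σ) (u : testE d σ →ₗ[ℂ] ℂ)
    (ξ : EuclideanSpace ℝ (Fin d)) : ℂ :=
  u ⟨expo ξ, expo_mem_testE hσ ξ⟩

/-- `u ∈ E_(σ)(ℝ^d)`: the functional `u` is given by integration against a function `f` from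
`E_(σ)(ℝ^d)`. -/
def IsRegular {d : ℕ} {σ : ℝ} (u : testE d σ →ₗ[ℂ] ℂ) : Prop :=
  ∃ f : testE d σ, ∀ φ : testE d σ,
    MeasureTheory.Integrable (fun x => (f : EuclideanSpace ℝ (Fin d) → ℂ) x *
      (φ : EuclideanSpace ℝ (Fin d) → ℂ) x) ∧
    u φ = ∫ x, (f : EuclideanSpace ℝ (Fin d) → ℂ) x * (φ : EuclideanSpace ℝ (Fin d) → ℂ) x

/-- The function `(ln^σ t / W (ln t))^(1 / (σ - 1))` that governs the growth and the decay. -/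
def rate (σ t : ℝ) : ℝ :=
  (Real.log t ^ σ / lambertW (Real.log t)) ^ (1 / (σ - 1))

end ExtGevrey

end

/-! The weights satisfy M^τ M^τ' = M^(τ+τ') and beat every A^n, every h^(-n^σ) and every n^(an+b).
Hence, at the price of passing from τ to τ/2, all such factors are absorbed, and E_(σ) is described
by operator norms of derivatives against `M τ σ n` alone (`mem_testE_iff`). The link with the
Lambert function is a Legendre-type computation. If L = log r and w = W(L), then L = w e^w and the
rate equals L E with E = e^(w/(σ-1)). Up to constants this is the supremum over n of nL - τ n^σ log
n, reached for n of order E. Hence r^n is at most exp(h · rate) times the weight, and r^n exp(-h ·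
rate) is at most the weight for h large. Part (i) then follows by inserting the exponential into the
continuity estimate of u, since |D^α e_ξ| ≤ |ξ|^|α|. For part (ii), the decay of û against all
weights puts f = 𝓕⁻ û in E_(σ). Sending φ to its weighted derivatives on K embeds the seminorm of u
in an ℓ^∞ space; by Hahn–Banach u factors through a continuous functional there, so it commutes with
Bochner integrals of exponentials: u(𝓕ψ) = ∫ ψ û. With ψ = 𝓕⁻φ this gives u(φ) = ∫ f φ for compactly
supported φ. The class is non-quasianalytic, as exp(-1/x) supplies cutoffs χ. Since u ignores
functions vanishing near K, the formula forces f = f χ, and an arbitrary φ may be replaced by χφ. -/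

namespace ExtGevrey
open Filter Topology

/-! ### Growth properties of the weights -/

section Weight

variable {σ τ : ℝ}

theorem M_zero_right (hσ : 1 < σ) : M τ σ 0 = 1 := by
  simp [M, Real.zero_rpow (by linarith : σ ≠ 0)]

theorem one_le_M (hσ : 1 < σ) (hτ : 0 ≤ τ) (n : ℕ) : 1 ≤ M τ σ n := by
  rcases Nat.eq_zero_or_pos n with rfl | hn
  · rw [M_zero_right hσ]
  · exact Real.one_le_rpow (by exact_mod_cast hn) (by positivity)

/-- The absorption device used throughout: split τ into two halves and spend one of them on unwanted
factors. -/
theorem M_mul_M (hσ : 1 < σ) (τ τ' : ℝ) (n : ℕ) : M τ σ n * M τ' σ n = M (τ + τ') σ n := by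
  rcases Nat.eq_zero_or_pos n with rfl | hn
  · simp [M_zero_right hσ]
  · have : (0 : ℝ) < n := by exact_mod_cast hn
    rw [M, M, M, add_mul, Real.rpow_add this]

/-- Both bases are at most i + j, and the exponents add up by superadditivity of t ↦ t^σ. This is
what the Leibniz rule needs. -/
theorem M_mul_M_le_M_add (hσ : 1 < σ) (hτ : 0 ≤ τ) (i j : ℕ) :
    M τ σ i * M τ σ j ≤ M τ σ (i + j) := by
  rcases Nat.eq_zero_or_pos (i + j) with h | h
  · obtain ⟨rfl, rfl⟩ : i = 0 ∧ j = 0 := by omega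
    simp [M_zero_right hσ]
  · have hpos : (1 : ℝ) ≤ ((i + j : ℕ) : ℝ) := by exact_mod_cast h
    have key : ∀ k : ℕ, k ≤ i + j → M τ σ k ≤ ((i + j : ℕ) : ℝ) ^ (τ * (k : ℝ) ^ σ) := by
      intro k hk
      exact Real.rpow_le_rpow (by positivity) (by exact_mod_cast hk) (by positivity)
    refine (mul_le_mul (key i (by omega)) (key j (by omega)) (M_pos hσ j).le
      (by positivity)).trans ?_
    rw [← Real.rpow_add (by linarith), ← mul_add, M]
    refine Real.rpow_le_rpow_of_exponent_le hpos (mul_le_mul_of_nonneg_left ?_ hτ)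
    push_cast
    exact Real.add_rpow_le_rpow_add (by positivity) (by positivity) hσ.le

theorem exists_le_mul_of_eventually_le {a b : ℕ → ℝ} (hb : ∀ n, 0 < b n)
    (h : ∀ᶠ n in atTop, a n ≤ b n) : ∃ C : ℝ, 1 ≤ C ∧ ∀ n, a n ≤ C * b n := by
  obtain ⟨N, hN⟩ := eventually_atTop.1 h
  have h0 : ∀ s : Finset ℕ, 0 ≤ ∑ n ∈ s, |a n| / b n := fun s =>
    Finset.sum_nonneg fun n _ => div_nonneg (abs_nonneg _) (hb n).le
  refine ⟨1 + ∑ n ∈ Finset.range N, |a n| / b n, by linarith [h0 (Finset.range N)], fun n => ?_⟩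
  rw [← div_le_iff₀ (hb n)]
  rcases lt_or_ge n N with hn | hn
  · have h1 := Finset.single_le_sum (f := fun n => |a n| / b n)
      (fun n _ => div_nonneg (abs_nonneg _) (hb n).le) (Finset.mem_range.2 hn)
    have h2 : a n / b n ≤ |a n| / b n := by
      gcongr
      · exact (hb n).le
      · exact le_abs_self _
    linarith
  · have := (div_le_one (hb n)).2 (hN n hn)
    linarith [h0 (Finset.range N)]

theorem exists_pow_le_M (hσ : 1 < σ) (hτ : 0 < τ) (A : ℝ) :
    ∃ C : ℝ, 0 < C ∧ ∀ n : ℕ, |A| ^ n ≤ C * M τ σ n := by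
  obtain ⟨C, hC, h⟩ := pow_le_M (le_max_left 1 |A|) hτ hσ one_pos
  refine ⟨C, hC, fun n => ?_⟩
  have := h n
  rw [Real.one_rpow, mul_one] at this
  exact (pow_le_pow_left₀ (abs_nonneg A) (le_max_right 1 |A|) n).trans this

theorem exists_one_le_rpow_mul_M (hσ : 1 < σ) (hτ : 0 < τ) {h : ℝ} (hh : 0 < h) :
    ∃ C : ℝ, 0 < C ∧ ∀ n : ℕ, 1 ≤ C * (h ^ ((n : ℝ) ^ σ) * M τ σ n) := by
  obtain ⟨C, hC, hle⟩ := pow_le_M le_rfl hτ hσ hh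
  exact ⟨C, hC, fun n => by simpa [mul_assoc] using hle n⟩

theorem eventually_mul_le_rpow (hσ : 1 < σ) (hτ : 0 < τ) (c : ℝ) :
    ∀ᶠ n : ℕ in atTop, c * (n : ℝ) ≤ τ * (n : ℝ) ^ σ := by
  have hlim : Tendsto (fun n : ℕ => τ * (n : ℝ) ^ (σ - 1)) atTop atTop :=
    ((tendsto_rpow_atTop (by linarith)).comp tendsto_natCast_atTop_atTop).const_mul_atTop hτ
  filter_upwards [hlim.eventually_ge_atTop c, eventually_gt_atTop 0] with n hn h0
  have : (0 : ℝ) < n := by exact_mod_cast h0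
  rw [Real.rpow_sub_one this.ne', ← mul_div_assoc, le_div_iff₀ this] at hn
  exact hn

theorem exists_M_add_le (hσ : 1 < σ) (hτ : 0 < τ) (k : ℕ) :
    ∃ τ' : ℝ, 0 < τ' ∧ ∃ C : ℝ, 1 ≤ C ∧ ∀ n : ℕ, M τ' σ (n + k) ≤ C * M τ σ n := by
  -- For large n the base n + k is at most n², costing a factor 2 in the exponent, and (n + k)^σ ≤
  -- 2^σ n^σ costs the rest.
  refine ⟨τ / (2 * 2 ^ σ), by positivity, exists_le_mul_of_eventually_le (M_pos hσ) ?_⟩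
  filter_upwards [eventually_ge_atTop (max 2 k)] with n hn
  have h2 : (2 : ℝ) ≤ n := by exact_mod_cast (le_max_left 2 k).trans hn
  have hk : (k : ℝ) ≤ n := by exact_mod_cast (le_max_right 2 k).trans hn
  have h3 : ((n + k : ℕ) : ℝ) ≤ 2 * n := by push_cast; linarith
  have h4 : ((n + k : ℕ) : ℝ) ≤ (n : ℝ) ^ (2 : ℝ) := by
    rw [Real.rpow_two]; nlinarith
  calc M (τ / (2 * 2 ^ σ)) σ (n + k)
      ≤ ((n : ℝ) ^ (2 : ℝ)) ^ (τ / (2 * 2 ^ σ) * ((n + k : ℕ) : ℝ) ^ σ) :=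
        Real.rpow_le_rpow (by positivity) h4 (by positivity)
    _ ≤ ((n : ℝ) ^ (2 : ℝ)) ^ (τ / (2 * 2 ^ σ) * (2 * n) ^ σ) := by
        refine Real.rpow_le_rpow_of_exponent_le
          (Real.one_le_rpow (by linarith) (by norm_num)) ?_
        gcongr
    _ = M τ σ n := by
        rw [M, ← Real.rpow_mul (by positivity), Real.mul_rpow (by norm_num) (by positivity)]
        congr 1
        have : (2 : ℝ) ^ σ ≠ 0 := by positivity
        field_simp

/-- Once n ≥ 3, 2n + 1 ≤ n², so the left side is a power of n with exponent linear in n, eventually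
below τ n^σ. It absorbs the Gevrey growth of the derivatives of exp(-1/x). -/
theorem exists_pow_self_le_M (hσ : 1 < σ) (hτ : 0 < τ) (a b : ℕ) :
    ∃ C : ℝ, 1 ≤ C ∧ ∀ n : ℕ, (2 * n + 1 : ℝ) ^ (a * n + b) ≤ C * M τ σ n := by
  refine exists_le_mul_of_eventually_le (M_pos hσ) ?_
  filter_upwards [eventually_ge_atTop 3, eventually_mul_le_rpow hσ hτ (2 * a + 2 * b : ℕ)]
    with n hn hle
  have h3 : (3 : ℝ) ≤ n := by exact_mod_cast hn
  calc (2 * n + 1 : ℝ) ^ (a * n + b) ≤ ((n : ℝ) ^ 2) ^ (a * n + b) := by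
        gcongr
        nlinarith
    _ = (n : ℝ) ^ ((2 * (a * n + b) : ℕ) : ℝ) := by rw [← pow_mul, Real.rpow_natCast]
    _ ≤ M τ σ n := by
        refine Real.rpow_le_rpow_of_exponent_le (by linarith) (le_trans ?_ hle)
        rw [← Nat.cast_mul]
        norm_cast
        nlinarith [Nat.zero_le (b * (n - 1)),
          mul_le_mul_of_nonneg_left (show 1 ≤ n by omega) (Nat.zero_le b)]

end Weight

/-! ### The rate function as associated function of the weights -/

section Rate

variable {σ : ℝ}

/-- With w e^w = log t, the quotient (log t)^σ / w is (log t)^(σ-1) e^w, whose root is explicit. -/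
theorem rate_eq (hσ : 1 < σ) {t : ℝ} (ht : 1 < t) :
    rate σ t = Real.log t * Real.exp (lambertW (Real.log t) / (σ - 1)) := by
  have hL : 0 < Real.log t := Real.log_pos ht
  obtain ⟨hw, he⟩ := lambertW_spec hL.le
  set w := lambertW (Real.log t)
  have hw0 : 0 < w := by
    rcases hw.lt_or_eq with h | h
    · exact h
    · rw [← h, zero_mul] at he; linarith
  have hs : σ - 1 ≠ 0 := by linarith
  have h1 : Real.log t ^ σ / w = (Real.log t) ^ (σ - 1) * Real.exp w := by
    rw [Real.rpow_sub_one hL.ne', div_mul_eq_mul_div, div_eq_div_iff hw0.ne' hL.ne', mul_assoc,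
      mul_comm (Real.exp w), he]
  rw [rate, h1, Real.mul_rpow (by positivity) (by positivity), ← Real.rpow_mul hL.le,
    mul_one_div_cancel hs, Real.rpow_one, ← Real.exp_mul]
  congr 2
  field_simp

/-- The decay `exp (-h * rate σ r)` beats `r ^ n`, uniformly up to the factor `M τ σ n`. -/
theorem exists_pow_mul_exp_neg_rate_le (hσ : 1 < σ) {τ : ℝ} (hτ : 0 < τ) :
    ∃ h : ℝ, 0 < h ∧ ∀ (n : ℕ) (r : ℝ), 1 < r →
      r ^ n * Real.exp (-h * rate σ r) ≤ M τ σ n := by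
  have hs : 0 < σ - 1 := by linarith
  -- Chosen so that h^(σ-1) ≥ (σ-1)/τ; h ≥ 1 ensures that n > hE implies n > 1 and n ≥ E.
  set h : ℝ := max 1 (((σ - 1) / τ) ^ (1 / (σ - 1))) with hh
  have h1 : 1 ≤ h := le_max_left _ _
  have hpow : (σ - 1) / τ ≤ h ^ (σ - 1) := by
    have := Real.rpow_le_rpow (by positivity) (le_max_right 1 (((σ - 1) / τ) ^ (1 / (σ - 1)))) hs.le
    rwa [← Real.rpow_mul (by positivity), one_div_mul_cancel hs.ne', Real.rpow_one] at this
  refine ⟨h, by linarith, fun n r hr => ?_⟩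
  rw [rate_eq hσ hr]
  have hL : 0 < Real.log r := Real.log_pos hr
  obtain ⟨hw, he⟩ := lambertW_spec hL.le
  set w := lambertW (Real.log r)
  set L := Real.log r
  set E := Real.exp (w / (σ - 1)) with hE
  have hE1 : 1 ≤ E := Real.one_le_exp (by positivity)
  have hrn : r ^ n * Real.exp (-h * (L * E)) = Real.exp (L * (n - h * E)) := by
    rw [← Real.exp_log (show 0 < r ^ n by positivity), ← Real.exp_add, Real.log_pow]
    congr 1
    simp only [L]
    ring
  rw [hrn]
  -- Below the threshold the exponential alone suffices. Above it, E ≤ n/h bounds both w ≤ (σ-1) log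
  -- n and e^w = E^(σ-1), hence L n = w e^w n ≤ τ n^σ log n.
  rcases le_or_gt (n : ℝ) (h * E) with hle | hlt
  · refine le_trans ?_ (one_le_M hσ hτ.le n)
    rw [Real.exp_le_one_iff]
    exact mul_nonpos_of_nonneg_of_nonpos hL.le (by linarith)
  · have hn : (1 : ℝ) < n := by nlinarith
    have hn0 : (0 : ℝ) < n := by linarith
    have hlogn : 0 < Real.log n := Real.log_pos hn
    have hEn : E ≤ n / h := by rw [le_div_iff₀ (by linarith)]; linarith
    have hEexp : E ^ (σ - 1) = Real.exp w := by
      rw [hE, ← Real.exp_mul]; congr 1; field_simp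
    have hw1 : w ≤ (σ - 1) * Real.log n := by
      have : E ≤ n := by nlinarith
      have := Real.log_le_log (by positivity) this
      rw [hE, Real.log_exp, div_le_iff₀ hs] at this
      linarith
    have hexpw : Real.exp w ≤ (n : ℝ) ^ (σ - 1) / h ^ (σ - 1) := by
      rw [← hEexp, ← Real.div_rpow hn0.le (by linarith)]
      exact Real.rpow_le_rpow (by positivity) hEn hs.le
    have hexpw' : (σ - 1) * Real.exp w ≤ τ * (n : ℝ) ^ (σ - 1) := by
      rw [le_div_iff₀ (by positivity)] at hexpw
      rw [div_le_iff₀ hτ] at hpow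
      have h5 := mul_le_mul_of_nonneg_left hpow (Real.exp_pos w).le
      nlinarith
    rw [M, Real.rpow_def_of_pos hn0]
    refine Real.exp_le_exp.2 ?_
    calc L * (n - h * E) ≤ L * n := by
          have : 0 ≤ h * E := by positivity
          nlinarith
      _ = w * Real.exp w * n := by rw [he]
      _ ≤ (σ - 1) * Real.log n * Real.exp w * n := by gcongr
      _ = ((σ - 1) * Real.exp w) * Real.log n * n := by ring
      _ ≤ (τ * (n : ℝ) ^ (σ - 1)) * Real.log n * n := by gcongr
      _ = Real.log n * (τ * (n : ℝ) ^ σ) := by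
          rw [Real.rpow_sub_one hn0.ne']; field_simp

/-- The associated function of the weights `ε ^ (n ^ σ) * M τ σ n` is bounded by `rate σ`. -/
theorem exists_pow_le_exp_rate_mul (hσ : 1 < σ) {τ ε : ℝ} (hτ : 0 < τ) (hε : 0 < ε) :
    ∃ h : ℝ, 0 < h ∧ ∃ C : ℝ, 0 < C ∧ ∀ (n : ℕ) (r : ℝ), 1 < r →
      r ^ n ≤ C * Real.exp (h * rate σ r) * (ε ^ ((n : ℝ) ^ σ) * M τ σ n) := by
  have hs : 0 < σ - 1 := by linarith
  obtain ⟨C, hC, hCle⟩ := exists_one_le_rpow_mul_M hσ (half_pos hτ) hε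
  -- The factor 2 appears because only τ/2 is available: the other half of τ compensates the powers
  -- of ε.
  set B : ℝ := max 1 ((2 * (σ - 1) / τ) ^ (1 / (σ - 1))) with hB
  have h1 : 1 ≤ B := le_max_left _ _
  have hpow : 2 * (σ - 1) / τ ≤ B ^ (σ - 1) := by
    have := Real.rpow_le_rpow (by positivity)
      (le_max_right 1 ((2 * (σ - 1) / τ) ^ (1 / (σ - 1)))) hs.le
    rwa [← Real.rpow_mul (by positivity), one_div_mul_cancel hs.ne', Real.rpow_one] at this
  refine ⟨B, by linarith, C, hC, fun n r hr => ?_⟩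
  suffices hkey : r ^ n ≤ Real.exp (B * rate σ r) * M (τ / 2) σ n by
    have h2 : M τ σ n = M (τ / 2) σ n * M (τ / 2) σ n := by rw [M_mul_M hσ, add_halves]
    have h3 := mul_le_mul_of_nonneg_left (hCle n)
      (mul_nonneg (Real.exp_pos (B * rate σ r)).le (M_pos hσ (τ := τ / 2) n).le)
    calc r ^ n ≤ _ := hkey
      _ = Real.exp (B * rate σ r) * M (τ / 2) σ n * 1 := by ring
      _ ≤ _ := h3
      _ = _ := by rw [h2]; ring
  rw [rate_eq hσ hr]
  have hL : 0 < Real.log r := Real.log_pos hr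
  obtain ⟨hw, he⟩ := lambertW_spec hL.le
  set w := lambertW (Real.log r)
  set L := Real.log r
  set E := Real.exp (w / (σ - 1)) with hE
  have hE1 : 1 ≤ E := Real.one_le_exp (by positivity)
  have hrn : r ^ n = Real.exp (L * n) := by
    rw [← Real.exp_log (show 0 < r ^ n by positivity), Real.log_pow, mul_comm]
  rw [hrn]
  rcases le_or_gt (n : ℝ) (B * E) with hle | hlt
  · refine le_trans ?_ (le_mul_of_one_le_right (by positivity) (one_le_M hσ (by linarith) n))
    refine Real.exp_le_exp.2 ?_
    nlinarith
  · have hn : (1 : ℝ) < n := by nlinarith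
    have hn0 : (0 : ℝ) < n := by linarith
    refine le_trans ?_ (le_mul_of_one_le_left (M_pos hσ n).le (Real.one_le_exp (by positivity)))
    rw [M, Real.rpow_def_of_pos hn0]
    refine Real.exp_le_exp.2 ?_
    have hEexp : E ^ (σ - 1) = Real.exp w := by
      rw [hE, ← Real.exp_mul]; congr 1; field_simp
    have hw1 : w ≤ (σ - 1) * Real.log n := by
      have : E ≤ n := by nlinarith
      have := Real.log_le_log (by positivity) this
      rw [hE, Real.log_exp, div_le_iff₀ hs] at this
      linarith
    have hnpow : B ^ (σ - 1) * Real.exp w ≤ (n : ℝ) ^ (σ - 1) := by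
      rw [← hEexp, ← Real.mul_rpow (by linarith) (by positivity)]
      exact Real.rpow_le_rpow (by positivity) hlt.le hs.le
    have h5 : (σ - 1) * Real.exp w ≤ τ / 2 * (n : ℝ) ^ (σ - 1) := by
      rw [div_le_iff₀ hτ] at hpow
      have := mul_le_mul_of_nonneg_left hpow (Real.exp_pos w).le
      nlinarith
    have hlogn : 0 < Real.log n := Real.log_pos hn
    calc L * n = w * Real.exp w * n := by rw [he]
      _ ≤ (σ - 1) * Real.log n * Real.exp w * n := by gcongr
      _ = ((σ - 1) * Real.exp w) * Real.log n * n := by ring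
      _ ≤ (τ / 2 * (n : ℝ) ^ (σ - 1)) * Real.log n * n := by gcongr
      _ = Real.log n * (τ / 2 * (n : ℝ) ^ σ) := by
          rw [Real.rpow_sub_one hn0.ne']; field_simp

end Rate

/-! ### Symmetry of higher derivatives -/

section Symmetric

/-- The induction replaces f by its derivative, so the target space has to vary inside it. A swap
fixing the last argument is the induction hypothesis for `fderiv ℝ f`; the swap of the last two is
symmetry of the second derivative. -/
theorem iteratedFDeriv_comp_adjacent_swap {E : Type} [NormedAddCommGroup E] [NormedSpace ℝ E]
    (n : ℕ) : ∀ {F : Type} [NormedAddCommGroup F] [NormedSpace ℝ F] {f : E → F},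
      ContDiff ℝ ∞ f → ∀ (x : E) (v : Fin (n + 1) → E) (i : Fin n),
        iteratedFDeriv ℝ (n + 1) f x (v ∘ Equiv.swap i.castSucc i.succ) =
          iteratedFDeriv ℝ (n + 1) f x v := by
  induction n with
  | zero => intro F _ _ f _ x v i; exact i.elim0
  | succ n ih =>
    intro F _ _ f hf x v i
    have hf1 : ContDiff ℝ ∞ (fderiv ℝ f) := hf.fderiv_right (by norm_cast)
    have hf2 : ContDiff ℝ ∞ (fderiv ℝ (fderiv ℝ f)) := hf1.fderiv_right (by norm_cast)
    induction i using Fin.lastCases with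
    | last =>
      have hsymm : ∀ y a b, fderiv ℝ (fderiv ℝ f) y a b = fderiv ℝ (fderiv ℝ f) y b a := by
        intro y a b
        exact (hf.contDiffAt.isSymmSndFDerivAt
          (by simpa using (WithTop.coe_le_coe.2 le_top :
            ((2 : ℕ∞) : WithTop ℕ∞) ≤ ((⊤ : ℕ∞) : WithTop ℕ∞)))).eq a b
      -- Evaluation at a and b is continuous linear, so it commutes with the outer n derivatives,
      -- and pointwise symmetry passes through them.
      have heval : ∀ m a b, iteratedFDeriv ℝ n (fderiv ℝ (fderiv ℝ f)) x m a b =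
          iteratedFDeriv ℝ n (fun y => fderiv ℝ (fderiv ℝ f) y a b) x m := by
        intro m a b
        have h1 := congrArg (fun S => S m) <|
          (ContinuousLinearMap.apply ℝ (E →L[ℝ] F) a).iteratedFDeriv_comp_left
          (x := x) hf2.contDiffAt (i := n) (by exact_mod_cast le_top)
        have h2 := congrArg (fun S => S m) <|
          (ContinuousLinearMap.apply ℝ F b).iteratedFDeriv_comp_left (x := x)
          (f := fun y => fderiv ℝ (fderiv ℝ f) y a) (hf2.clm_apply contDiff_const).contDiffAt
          (i := n) (by exact_mod_cast le_top)
        exact (h2.trans (congrArg (fun l => l b) h1)).symm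
      have hflip : ∀ m a b, iteratedFDeriv ℝ n (fderiv ℝ (fderiv ℝ f)) x m a b =
          iteratedFDeriv ℝ n (fderiv ℝ (fderiv ℝ f)) x m b a := by
        intro m a b
        simp only [heval, hsymm _ a b]
      simp only [iteratedFDeriv_succ_apply_right, Function.comp_apply, Fin.succ_last,
        Equiv.swap_apply_right, Fin.init, Equiv.swap_apply_left]
      rw [hflip]
      congr 3
      funext j
      simp only [Fin.init, Function.comp_apply]
      congr 1
      rw [Equiv.swap_apply_of_ne_of_ne]
      · simp [Fin.ext_iff, j.2.ne]
      · simp [Fin.ext_iff]; omega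
    | cast j =>
      rw [iteratedFDeriv_succ_apply_right, iteratedFDeriv_succ_apply_right (m := v),
        ← ih hf1 x (Fin.init v) j]
      congr 1
      · congr 1
        ext k
        simp only [Fin.init, Function.comp_apply]
        congr 1
        rw [← Fin.castSucc_succ, ← Function.Injective.map_swap (Fin.castSucc_injective _)]
      · simp only [Function.comp_apply]
        rw [Equiv.swap_apply_of_ne_of_ne]
        · simp [Fin.ext_iff]; omega
        · simp [Fin.ext_iff]; omega

/-- The iterated derivative of a smooth function is symmetric. -/
theorem iteratedFDeriv_comp_perm {E F : Type} [NormedAddCommGroup E] [NormedSpace ℝ E]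
    [NormedAddCommGroup F] [NormedSpace ℝ F] {f : E → F} (hf : ContDiff ℝ ∞ f) {n : ℕ} (x : E)
    (v : Fin n → E) (p : Equiv.Perm (Fin n)) :
    iteratedFDeriv ℝ n f x (v ∘ p) = iteratedFDeriv ℝ n f x v := by
  cases n with
  | zero => congr 1; ext i; exact i.elim0
  | succ n =>
    have hp : p ∈ Submonoid.closure
        (Set.range fun i : Fin n => Equiv.swap i.castSucc i.succ) := by
      rw [Equiv.Perm.mclosure_swap_castSucc_succ]; trivial
    induction hp using Submonoid.closure_induction generalizing v with
    | mem q hq =>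
      obtain ⟨i, rfl⟩ := hq
      exact iteratedFDeriv_comp_adjacent_swap n hf x v i
    | one => rfl
    | mul a b _ _ ha hb =>
      rw [Equiv.Perm.coe_mul, ← Function.comp_assoc, hb, ha]

theorem iteratedFDeriv_comp_equiv {E F : Type} [NormedAddCommGroup E] [NormedSpace ℝ E]
    [NormedAddCommGroup F] [NormedSpace ℝ F] {f : E → F} (hf : ContDiff ℝ ∞ f) {m n : ℕ} (x : E)
    (v : Fin n → E) (e : Fin m ≃ Fin n) :
    iteratedFDeriv ℝ m f x (v ∘ e) = iteratedFDeriv ℝ n f x v := by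
  obtain rfl : m = n := by simpa using Fintype.card_congr e
  exact iteratedFDeriv_comp_perm hf x v e

end Symmetric

/-! ### Operator norms from partial derivatives -/

section OpNorm

variable {d : ℕ}

theorem exists_partialD_eq {φ : EuclideanSpace ℝ (Fin d) → ℂ} (hφ : ContDiff ℝ ∞ φ) {n : ℕ}
    (k : Fin n → Fin d) : ∃ α : Fin d → ℕ, len α = n ∧ ∀ x,
      iteratedFDeriv ℝ n φ x (fun j => EuclideanSpace.single (k j) (1 : ℝ)) = partialD α φ x := by
  -- The multi-index counts how often each direction occurs; the bijection `e` sorts the directions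
  -- into the order used by `partialD`.
  let α : Fin d → ℕ := fun i => Fintype.card {j // k j = i}
  let e : Fin (len α) ≃ Fin n := finSigmaFinEquiv.symm.trans
    ((Equiv.sigmaCongrRight fun i => (Fintype.equivFin {j // k j = i}).symm).trans
      (Equiv.sigmaFiberEquiv k))
  refine ⟨α, by simpa using Fintype.card_congr e, fun x => ?_⟩
  rw [← iteratedFDeriv_comp_equiv hφ x _ e]
  unfold partialD
  congr 1
  ext1 j
  simp only [Function.comp_apply]
  congr 1
  exact ((Fintype.equivFin {j' // k j' = (finSigmaFinEquiv.symm j).1}).symm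
    (finSigmaFinEquiv.symm j).2).2

/-- Expanding each argument in the basis gives d^n terms. The maximum with 0 matters when d = 0 < n:
the hypothesis is then vacuous and C may be negative. -/
theorem opNorm_le_of_basis {n : ℕ}
    (T : ContinuousMultilinearMap ℝ (fun _ : Fin n => EuclideanSpace ℝ (Fin d)) ℂ) {C : ℝ}
    (hT : ∀ k : Fin n → Fin d, ‖T fun j => EuclideanSpace.single (k j) (1 : ℝ)‖ ≤ C) :
    ‖T‖ ≤ (max C 0) * (d : ℝ) ^ n := by
  refine ContinuousMultilinearMap.opNorm_le_bound (by positivity) fun v => ?_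
  have hv : v = fun j => ∑ i, (v j i) • EuclideanSpace.single i (1 : ℝ) := by
    ext j i
    simp [Finset.sum_apply, Pi.single_apply]
  conv_lhs => rw [hv]
  rw [ContinuousMultilinearMap.map_sum]
  refine (norm_sum_le _ _).trans ?_
  have hle : ∀ k : Fin n → Fin d,
      ‖T fun j => v j (k j) • EuclideanSpace.single (k j) (1 : ℝ)‖ ≤ max C 0 * ∏ j, ‖v j‖ := by
    intro k
    rw [ContinuousMultilinearMap.map_smul_univ, norm_smul, mul_comm, norm_prod]
    refine mul_le_mul ((hT k).trans (le_max_left _ _)) ?_ (by positivity) (by positivity)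
    exact Finset.prod_le_prod (fun _ _ => norm_nonneg _) fun j _ => PiLp.norm_apply_le _ _
  refine (Finset.sum_le_sum fun k _ => hle k).trans (le_of_eq ?_)
  simp only [Finset.sum_const, Finset.card_univ, Fintype.card_fun, Fintype.card_fin, nsmul_eq_mul]
  push_cast
  ring

end OpNorm

/-! ### Stability of the ultradifferentiable class -/

section UltraDiff

variable {E : Type} [NormedAddCommGroup E] [NormedSpace ℝ E] {σ : ℝ}

/-- Smooth functions on a normed space whose iterated derivatives grow, locally uniformly, slower
than every `M τ σ`, `τ > 0`. -/
def UltraDiff (σ : ℝ) (f : E → ℂ) : Prop :=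
  ContDiff ℝ ∞ f ∧ ∀ K : Set E, IsCompact K → ∀ τ : ℝ, 0 < τ → ∃ C : ℝ, 0 < C ∧
    ∀ x ∈ K, ∀ n : ℕ, ‖iteratedFDeriv ℝ n f x‖ ≤ C * M τ σ n

theorem UltraDiff.mul (hσ : 1 < σ) {φ ψ : E → ℂ} (hφ : UltraDiff σ φ) (hψ : UltraDiff σ ψ) :
    UltraDiff σ fun x => φ x * ψ x := by
  refine ⟨hφ.1.mul hψ.1, fun K hK τ hτ => ?_⟩
  obtain ⟨C, hC, hle⟩ := hφ.2 K hK (τ / 2) (half_pos hτ)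
  obtain ⟨C', hC', hle'⟩ := hψ.2 K hK (τ / 2) (half_pos hτ)
  obtain ⟨A, hA, hleA⟩ := exists_pow_le_M hσ (half_pos hτ) 2
  refine ⟨C * C' * A, by positivity, fun x hx n => ?_⟩
  refine (norm_iteratedFDeriv_mul_le hφ.1 hψ.1 x (by exact_mod_cast le_top)).trans ?_
  have hterm : ∀ i ∈ Finset.range (n + 1), (n.choose i : ℝ) * ‖iteratedFDeriv ℝ i φ x‖ *
      ‖iteratedFDeriv ℝ (n - i) ψ x‖ ≤ n.choose i * (C * C' * M (τ / 2) σ n) := by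
    intro i hi
    have hi' : i + (n - i) = n := by have := Finset.mem_range.1 hi; omega
    have hM := M_mul_M_le_M_add hσ (half_pos hτ).le i (n - i)
    rw [hi'] at hM
    have h0 := M_pos hσ (τ := τ / 2) i
    calc _ ≤ (n.choose i : ℝ) * (C * M (τ / 2) σ i) * (C' * M (τ / 2) σ (n - i)) := by
          gcongr
          · exact hle x hx i
          · exact hle' x hx _
      _ = n.choose i * (C * C' * (M (τ / 2) σ i * M (τ / 2) σ (n - i))) := by ring
      _ ≤ _ := by gcongr
  refine (Finset.sum_le_sum hterm).trans ?_
  rw [← Finset.sum_mul]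
  have h2 : ∑ i ∈ Finset.range (n + 1), (n.choose i : ℝ) = 2 ^ n := by
    exact_mod_cast Nat.sum_range_choose n
  have h3 := hleA n
  rw [abs_of_pos two_pos] at h3
  have h0 := M_pos hσ (τ := τ / 2) n
  rw [h2]
  calc _ ≤ A * M (τ / 2) σ n * (C * C' * M (τ / 2) σ n) := by gcongr
    _ = C * C' * A * (M (τ / 2) σ n * M (τ / 2) σ n) := by ring
    _ = _ := by rw [M_mul_M hσ, add_halves]

theorem UltraDiff.const (hσ : 1 < σ) (c : ℂ) : UltraDiff σ fun _ : E => c := by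
  refine ⟨contDiff_const, fun K hK τ hτ => ⟨‖c‖ + 1, by positivity, fun x _ n => ?_⟩⟩
  have h1 := one_le_M hσ hτ.le n
  cases n with
  | zero => simp only [norm_iteratedFDeriv_zero]; nlinarith [norm_nonneg c]
  | succ n => rw [iteratedFDeriv_const_of_ne (by simp)]; simp; nlinarith [norm_nonneg c]

theorem UltraDiff.prod (hσ : 1 < σ) {ι : Type*} (s : Finset ι) {φ : ι → E → ℂ}
    (hφ : ∀ i ∈ s, UltraDiff σ (φ i)) : UltraDiff σ fun x => ∏ i ∈ s, φ i x := by
  classical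
  induction s using Finset.induction_on with
  | empty => simpa using UltraDiff.const hσ 1
  | insert a s ha ih =>
    simp only [Finset.prod_insert ha]
    exact (hφ a (by simp)).mul hσ (ih fun i hi => hφ i (by simp [hi]))

theorem UltraDiff.comp_add_right {φ : E → ℂ} (hφ : UltraDiff σ φ) (a : E) :
    UltraDiff σ fun x => φ (x + a) := by
  refine ⟨hφ.1.comp (contDiff_id.add contDiff_const), fun K hK τ hτ => ?_⟩
  obtain ⟨C, hC, hle⟩ := hφ.2 _ (hK.image (continuous_add_const a)) τ hτ
  refine ⟨C, hC, fun x hx n => ?_⟩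
  rw [iteratedFDeriv_comp_add_right]
  exact hle _ ⟨x, hx, rfl⟩ n

theorem UltraDiff.comp_clm (hσ : 1 < σ) {E' : Type} [NormedAddCommGroup E'] [NormedSpace ℝ E']
    {φ : E → ℂ} (hφ : UltraDiff σ φ) (T : E' →L[ℝ] E) : UltraDiff σ fun x => φ (T x) := by
  refine ⟨hφ.1.comp T.contDiff, fun K hK τ hτ => ?_⟩
  obtain ⟨C, hC, hle⟩ := hφ.2 _ (hK.image T.continuous) (τ / 2) (half_pos hτ)
  obtain ⟨A, hA, hleA⟩ := exists_pow_le_M hσ (half_pos hτ) ‖T‖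
  refine ⟨C * A, by positivity, fun x hx n => ?_⟩
  have h1 : iteratedFDeriv ℝ n (fun x => φ (T x)) x =
      (iteratedFDeriv ℝ n φ (T x)).compContinuousLinearMap fun _ => T :=
    T.iteratedFDeriv_comp_right hφ.1 x (by exact_mod_cast le_top)
  rw [h1]
  have h2 := hleA n
  rw [abs_norm] at h2
  have h0 := M_pos hσ (τ := τ / 2) n
  calc _ ≤ _ := ContinuousMultilinearMap.norm_compContinuousLinearMap_le _ _
    _ ≤ C * M (τ / 2) σ n * (A * M (τ / 2) σ n) := by
        rw [Finset.prod_const, Finset.card_univ, Fintype.card_fin]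
        gcongr
        exact hle _ ⟨x, hx, rfl⟩ n
    _ = C * A * (M (τ / 2) σ n * M (τ / 2) σ n) := by ring
    _ = _ := by rw [M_mul_M hσ, add_halves]

/-- Derivatives of order n + 1 of f are those of order n of g, and the weights increase; order zero
is bounded by continuity on K. -/
theorem UltraDiff.of_hasDerivAt (hσ : 1 < σ) {f g : ℝ → ℂ} (hg : UltraDiff σ g)
    (hf : ∀ x, HasDerivAt f (g x) x) : UltraDiff σ f := by
  have hd : deriv f = g := funext fun x => (hf x).deriv
  have hsm : ContDiff ℝ ∞ f :=
    contDiff_infty_iff_deriv.2 ⟨fun x => (hf x).differentiableAt, hd ▸ hg.1⟩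
  refine ⟨hsm, fun K hK τ hτ => ?_⟩
  obtain ⟨C, hC, hle⟩ := hg.2 K hK τ hτ
  obtain ⟨B, hB⟩ := hK.exists_bound_of_continuousOn hsm.continuous.continuousOn
  refine ⟨max B C, lt_max_of_lt_right hC, fun x hx n => ?_⟩
  cases n with
  | zero =>
    rw [M_zero_right hσ, mul_one, norm_iteratedFDeriv_zero]
    exact (hB x hx).trans (le_max_left _ _)
  | succ n =>
    rw [norm_iteratedFDeriv_eq_norm_iteratedDeriv, iteratedDeriv_succ', hd,
      ← norm_iteratedFDeriv_eq_norm_iteratedDeriv]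
    have h1 := M_mul_M_le_M_add hσ hτ.le n 1
    have h2 := one_le_M hσ hτ.le 1
    have h0 := M_pos hσ (τ := τ) n
    calc _ ≤ _ := hle x hx n
      _ ≤ max B C * M τ σ (n + 1) := by
        gcongr
        · exact le_max_right _ _
        · nlinarith

end UltraDiff

/-! ### Description of E_(σ) by operator norms -/

section TestE

variable {d : ℕ} {σ : ℝ}

theorem norm_partialD_le (α : Fin d → ℕ) (φ : EuclideanSpace ℝ (Fin d) → ℂ)
    (x : EuclideanSpace ℝ (Fin d)) : ‖partialD α φ x‖ ≤ ‖iteratedFDeriv ℝ (len α) φ x‖ := by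
  unfold partialD
  refine (ContinuousMultilinearMap.le_opNorm _ _).trans ?_
  simp

/-- Membership in `E_(σ)` in terms of the operator norms of the iterated derivatives. -/
theorem mem_testE_iff (hσ : 1 < σ) {φ : EuclideanSpace ℝ (Fin d) → ℂ} :
    φ ∈ testE d σ ↔ UltraDiff σ φ := by
  simp only [testE, Submodule.mem_iInf]
  constructor
  · intro h
    refine ⟨(h 1 one_pos).1, fun K hK τ hτ => ?_⟩
    obtain ⟨C, hC, hle⟩ := (h (τ / 2) (half_pos hτ)).2 K hK 1 one_pos
    obtain ⟨C', hC', hle'⟩ := exists_pow_le_M hσ (half_pos hτ) (d : ℝ)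
    refine ⟨C * C', by positivity, fun x hx n => ?_⟩
    have h1 : ‖iteratedFDeriv ℝ n φ x‖ ≤ max (C * M (τ / 2) σ n) 0 * (d : ℝ) ^ n := by
      refine opNorm_le_of_basis _ fun k => ?_
      obtain ⟨α, hα, he⟩ := exists_partialD_eq (h 1 one_pos).1 k
      rw [he]
      simpa [hα] using hle x hx α
    have hM := M_pos hσ (τ := τ / 2) n
    rw [max_eq_left (by positivity)] at h1
    have h2 := hle' n
    rw [Nat.abs_cast] at h2
    calc _ ≤ _ := h1
      _ ≤ C * M (τ / 2) σ n * (C' * M (τ / 2) σ n) := by gcongr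
      _ = C * C' * (M (τ / 2) σ n * M (τ / 2) σ n) := by ring
      _ = _ := by rw [M_mul_M hσ, add_halves]
  · rintro ⟨h, hφ⟩ τ hτ
    refine ⟨h, fun K hK η hη => ?_⟩
    obtain ⟨C, hC, hle⟩ := hφ K hK (τ / 2) (half_pos hτ)
    obtain ⟨C', hC', hle'⟩ := exists_one_le_rpow_mul_M hσ (half_pos hτ) hη
    refine ⟨C * C', by positivity, fun x hx α => ?_⟩
    have hM := M_pos hσ (τ := τ / 2) (len α)
    calc _ ≤ _ := norm_partialD_le α φ x
      _ ≤ C * M (τ / 2) σ (len α) * 1 := by rw [mul_one]; exact hle x hx _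
      _ ≤ C * M (τ / 2) σ (len α) *
          (C' * (η ^ ((len α : ℝ) ^ σ) * M (τ / 2) σ (len α))) := by gcongr; exact hle' _
      _ = C * C' * η ^ ((len α : ℝ) ^ σ) * (M (τ / 2) σ (len α) * M (τ / 2) σ (len α)) := by ring
      _ = _ := by rw [M_mul_M hσ, add_halves]

end TestE

/-! ### Non-quasianalyticity: cutoff functions -/

section Cutoff

open Polynomial in
/-- The polynomials `P n` with `iteratedDeriv n expNegInvGlue x = P n (1 / x) * expNegInvGlue x`. -/
noncomputable def gluePoly : ℕ → ℝ[X]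
  | 0 => 1
  | n + 1 => X ^ 2 * (gluePoly n - derivative (gluePoly n))

theorem iteratedDeriv_expNegInvGlue (n : ℕ) :
    iteratedDeriv n expNegInvGlue = fun x => (gluePoly n).eval x⁻¹ * expNegInvGlue x := by
  induction n with
  | zero => simp [gluePoly]
  | succ n ih =>
    rw [iteratedDeriv_succ, ih]
    exact funext fun x => (expNegInvGlue.hasDerivAt_polynomial_eval_inv_mul _ x).deriv

theorem natDegree_gluePoly_le (n : ℕ) : (gluePoly n).natDegree ≤ 2 * n := by
  induction n with
  | zero => simp [gluePoly]
  | succ n ih =>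
    rw [gluePoly]
    have h1 := Polynomial.natDegree_derivative_le (gluePoly n)
    have h2 := Polynomial.natDegree_sub_le (gluePoly n) (Polynomial.derivative (gluePoly n))
    refine Polynomial.natDegree_mul_le.trans ?_
    rw [Polynomial.natDegree_X_pow]
    omega

/-- As the degree is at most 2n, differentiation multiplies coefficients by at most 2n, so each step
of the recursion costs a factor 1 + 2n. -/
theorem abs_coeff_gluePoly_le (n k : ℕ) : |(gluePoly n).coeff k| ≤ (2 * n + 1 : ℝ) ^ n := by
  induction n generalizing k with
  | zero => rw [gluePoly, Polynomial.coeff_one]; split_ifs <;> simp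
  | succ n ih =>
    rw [gluePoly, Polynomial.coeff_X_pow_mul']
    split_ifs with hk
    · rw [Polynomial.coeff_sub, Polynomial.coeff_derivative]
      have h1 : |(gluePoly n).coeff (k - 2 + 1) * ((k - 2 : ℕ) + 1 : ℝ)| ≤
          (2 * n + 1 : ℝ) ^ n * (2 * n) := by
        rcases le_or_gt (k - 2 + 1) (2 * n) with h | h
        · rw [abs_mul]
          have h2 : ((k - 2 : ℕ) + 1 : ℝ) ≤ 2 * n := by exact_mod_cast h
          rw [abs_of_nonneg (show (0 : ℝ) ≤ ((k - 2 : ℕ) + 1 : ℝ) by positivity)]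
          gcongr
          exact ih _
        · rw [Polynomial.coeff_eq_zero_of_natDegree_lt ((natDegree_gluePoly_le n).trans_lt h)]
          simp only [zero_mul, abs_zero]
          positivity
      calc _ ≤ _ := abs_sub _ _
        _ ≤ (2 * n + 1 : ℝ) ^ n + (2 * n + 1 : ℝ) ^ n * (2 * n) := add_le_add (ih _) h1
        _ = (2 * n + 1 : ℝ) ^ (n + 1) := by ring
        _ ≤ _ := by push_cast; gcongr; linarith
    · rw [abs_zero]; positivity

/-- With y = 1/x, y^k e^(-y) ≤ k! ≤ (2n+1)^(2n). The coefficients contribute (2n+1)^n and the number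
of terms one more factor. -/
theorem abs_iteratedDeriv_expNegInvGlue_le (n : ℕ) (x : ℝ) :
    |iteratedDeriv n expNegInvGlue x| ≤ (2 * n + 1 : ℝ) ^ (3 * n + 1) := by
  rw [iteratedDeriv_expNegInvGlue]
  rcases le_or_gt x 0 with hx | hx
  · simp only [expNegInvGlue.zero_of_nonpos hx, mul_zero, abs_zero]
    positivity
  · have hy : 0 < x⁻¹ := inv_pos.2 hx
    have hg : expNegInvGlue x = Real.exp (-x⁻¹) := by simp [expNegInvGlue, not_le.2 hx]
    simp only [hg]
    set y := x⁻¹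
    rw [Polynomial.eval_eq_sum_range' (Nat.lt_succ_of_le (natDegree_gluePoly_le n)), Finset.sum_mul]
    have hterm : ∀ k ∈ Finset.range (2 * n).succ,
        |(gluePoly n).coeff k * y ^ k * Real.exp (-y)| ≤
          (2 * n + 1 : ℝ) ^ n * (2 * n + 1 : ℝ) ^ (2 * n) := by
      intro k hk
      have hk' : k ≤ 2 * n := Nat.lt_succ_iff.1 (Finset.mem_range.1 hk)
      rw [mul_assoc, abs_mul]
      refine mul_le_mul (abs_coeff_gluePoly_le n k) ?_ (abs_nonneg _) (by positivity)
      rw [abs_of_nonneg (by positivity), Real.exp_neg, ← div_eq_mul_inv,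
        div_le_iff₀ (Real.exp_pos _)]
      have h1 := Real.pow_div_factorial_le_exp y hy.le k
      rw [div_le_iff₀ (by positivity)] at h1
      have h2 : (k.factorial : ℝ) ≤ (2 * n + 1 : ℝ) ^ (2 * n) := by
        have h3 : k.factorial ≤ (2 * n + 1) ^ (2 * n) :=
          (Nat.factorial_le_pow k).trans ((Nat.pow_le_pow_left (by omega) k).trans
            (Nat.pow_le_pow_right (by omega) hk'))
        exact_mod_cast h3
      calc _ ≤ _ := h1
        _ = k.factorial * Real.exp y := mul_comm _ _
        _ ≤ _ := by gcongr
    refine (Finset.abs_sum_le_sum_abs _ _).trans ((Finset.sum_le_sum hterm).trans (le_of_eq ?_))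
    rw [Finset.sum_const, Finset.card_range, nsmul_eq_mul]
    push_cast
    ring

variable {σ : ℝ}

theorem ultraDiff_expNegInvGlue (hσ : 1 < σ) :
    UltraDiff σ fun x : ℝ => (expNegInvGlue x : ℂ) := by
  refine ⟨Complex.ofRealCLM.contDiff.comp expNegInvGlue.contDiff, fun K _ τ hτ => ?_⟩
  obtain ⟨C, hC, hle⟩ := exists_pow_self_le_M hσ hτ 3 1
  refine ⟨C, by linarith, fun x _ n => le_trans ?_ (hle n)⟩
  have h := Complex.ofRealLI.norm_iteratedFDeriv_comp_left (f := expNegInvGlue) (x := x)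
    (n := ∞) (i := n) expNegInvGlue.contDiff.contDiffAt (by exact_mod_cast le_top)
  refine h.le.trans ?_
  rw [norm_iteratedFDeriv_eq_norm_iteratedDeriv]
  exact abs_iteratedDeriv_expNegInvGlue_le n x

/-- The normalized primitive of a bump supported in [0, 1]; integrating avoids any estimate for the
derivatives of a quotient. -/
theorem exists_ultraDiff_step (hσ : 1 < σ) :
    ∃ s : ℝ → ℂ, UltraDiff σ s ∧ (∀ x ≤ 0, s x = 0) ∧ ∀ x, 1 ≤ x → s x = 1 := by
  let b : ℝ → ℂ := fun x => (expNegInvGlue x : ℂ) * (expNegInvGlue (1 - x) : ℂ)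
  have hb : UltraDiff σ b := by
    refine (ultraDiff_expNegInvGlue hσ).mul hσ ?_
    have h1 := ((ultraDiff_expNegInvGlue hσ).comp_add_right 1).comp_clm hσ
      (-ContinuousLinearMap.id ℝ ℝ)
    have h2 : (fun x : ℝ => (expNegInvGlue (1 - x) : ℂ)) =
        fun x => (expNegInvGlue ((-ContinuousLinearMap.id ℝ ℝ) x + 1) : ℂ) := by
      funext x
      congr 2
      simp
      ring
    rw [h2]
    exact h1
  have hbc : Continuous b := hb.1.continuous
  set c := ∫ x in (0 : ℝ)..1, b x with hc
  have hc0 : c ≠ 0 := by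
    have h1 : c = ((∫ x in (0 : ℝ)..1, expNegInvGlue x * expNegInvGlue (1 - x) : ℝ) : ℂ) := by
      rw [hc, ← intervalIntegral.integral_ofReal]
      simp [b]
    have h2 : 0 < ∫ x in (0 : ℝ)..1, expNegInvGlue x * expNegInvGlue (1 - x) := by
      refine intervalIntegral.intervalIntegral_pos_of_pos_on ?_ (fun x hx => ?_) one_pos
      · have : Continuous expNegInvGlue := (expNegInvGlue.contDiff (n := 0)).continuous
        exact (this.mul (this.comp (by fun_prop : Continuous fun x : ℝ => 1 - x))).intervalIntegrable
          _ _
      · exact mul_pos (expNegInvGlue.pos_of_pos hx.1)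
          (expNegInvGlue.pos_of_pos (by linarith [hx.2]))
    rw [h1]
    exact_mod_cast h2.ne'
  have hint : ∀ p q, IntervalIntegrable b MeasureTheory.volume p q := fun p q =>
    hbc.intervalIntegrable p q
  refine ⟨fun x => c⁻¹ * ∫ y in (0 : ℝ)..x, b y, ?_, fun x hx => ?_, fun x hx => ?_⟩
  · refine ((UltraDiff.const hσ c⁻¹).mul hσ hb).of_hasDerivAt hσ fun x => ?_
    exact (intervalIntegral.integral_hasDerivAt_right (hint 0 x)
      (hbc.stronglyMeasurableAtFilter _ _) hbc.continuousAt).const_mul _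
  · have : ∫ y in (0 : ℝ)..x, b y = 0 := by
      rw [intervalIntegral.integral_symm, neg_eq_zero]
      refine (intervalIntegral.integral_congr fun y hy => ?_).trans
        intervalIntegral.integral_zero
      rw [Set.uIcc_of_le hx] at hy
      simp [b, expNegInvGlue.zero_of_nonpos hy.2]
    simp [this]
  · have h1 : ∫ y in (1 : ℝ)..x, b y = 0 := by
      refine (intervalIntegral.integral_congr fun y hy => ?_).trans
        intervalIntegral.integral_zero
      rw [Set.uIcc_of_le hx] at hy
      simp [b, expNegInvGlue.zero_of_nonpos (show 1 - y ≤ 0 by linarith [hy.1])]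
    have h2 := intervalIntegral.integral_add_adjacent_intervals (hint 0 1) (hint 1 x)
    simp only [← h2, h1, add_zero]
    exact inv_mul_cancel₀ hc0

/-- Compactly supported cutoff functions in `E_(σ)`. -/
theorem exists_cutoff {d : ℕ} (hσ : 1 < σ) (R : ℝ) :
    ∃ χ ∈ testE d σ, HasCompactSupport χ ∧ ∀ x, ‖x‖ ≤ R → χ x = 1 := by
  obtain ⟨s, hs, hs0, hs1⟩ := exists_ultraDiff_step hσ
  let P : Fin d → EuclideanSpace ℝ (Fin d) →L[ℝ] ℝ := fun i => EuclideanSpace.proj i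
  -- The i-th factor is 1 for |x_i| ≤ R and 0 for |x_i| ≥ R + 1.
  refine ⟨fun x => ∏ i, s (P i x + (R + 1)) * s ((-P i) x + (R + 1)), ?_, ?_, fun x hx => ?_⟩
  · rw [mem_testE_iff hσ]
    refine UltraDiff.prod hσ _ fun i _ => UltraDiff.mul hσ ?_ ?_
    · exact (hs.comp_add_right (R + 1)).comp_clm hσ (P i)
    · exact (hs.comp_add_right (R + 1)).comp_clm hσ (-P i)
  · let e := (EuclideanSpace.equiv (Fin d) ℝ).toHomeomorph
    refine HasCompactSupport.intro (K := e ⁻¹' Set.univ.pi fun _ => Set.Icc (-(R + 1)) (R + 1))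
      (e.isCompact_preimage.2 (isCompact_univ_pi fun _ => isCompact_Icc)) fun x hx => ?_
    have : ∃ i, ¬ (-(R + 1) ≤ x i ∧ x i ≤ R + 1) := by
      by_contra! h
      exact hx fun i _ => h i
    obtain ⟨i, hi⟩ := this
    refine Finset.prod_eq_zero (Finset.mem_univ i) ?_
    have hP : P i x = x i := rfl
    rw [neg_apply, hP, mul_eq_zero]
    rcases lt_or_ge (x i) (-(R + 1)) with h | h
    · exact Or.inl (hs0 _ (by linarith))
    · exact Or.inr (hs0 _ (by linarith [not_le.1 fun h' => hi ⟨h, h'⟩]))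
  · refine Finset.prod_eq_one fun i _ => ?_
    have hP : P i x = x i := rfl
    have h1 : |x i| ≤ R := (PiLp.norm_apply_le x i).trans hx
    have h2 := abs_le.1 h1
    rw [neg_apply, hP, hs1 _ (by linarith), hs1 _ (by linarith), mul_one]

end Cutoff

/-! ### Derivatives of exponentials and their dependence on the frequency -/

section Expo

variable {d : ℕ}

theorem hasFDerivAt_expo (ξ x : EuclideanSpace ℝ (Fin d)) :
    HasFDerivAt (expo ξ) (expo ξ x • (-(2 * Real.pi * Complex.I) : ℂ) •
      (Complex.ofRealCLM.comp ((innerSL ℝ) ξ))) x := by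
  let L : EuclideanSpace ℝ (Fin d) →L[ℝ] ℂ :=
    (-(2 * Real.pi * Complex.I) : ℂ) • (Complex.ofRealCLM.comp ((innerSL ℝ) ξ))
  have hL : expo ξ = fun x => Complex.exp (L x) := by
    funext x
    simp [expo, L, real_inner_comm]
  rw [hL]
  exact L.hasFDerivAt.cexp

theorem iteratedFDeriv_expo_apply (ξ x : EuclideanSpace ℝ (Fin d)) (n : ℕ)
    (v : Fin n → EuclideanSpace ℝ (Fin d)) :
    iteratedFDeriv ℝ n (expo ξ) x v =
      expo ξ x * ∏ j, (-(2 * Real.pi * Complex.I) * (inner ℝ ξ (v j) : ℝ)) := by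
  induction n with
  | zero => simp
  | succ n ih =>
    have h1 := congrArg (fun S => S (Fin.init v)) <|
      (ContinuousLinearMap.apply ℝ ℂ (v (Fin.last n))).iteratedFDeriv_comp_left (x := x)
        (((contDiff_expo ξ).fderiv_right (m := ∞) (by norm_cast)).contDiffAt) (i := n)
        (by exact_mod_cast le_top)
    rw [iteratedFDeriv_succ_apply_right]
    refine h1.symm.trans ?_
    let c : ℂ := -(2 * Real.pi * Complex.I) * (inner ℝ ξ (v (Fin.last n)) : ℝ)
    have h2 : (ContinuousLinearMap.apply ℝ ℂ (v (Fin.last n))) ∘ fderiv ℝ (expo ξ) =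
        c • expo ξ := by
      funext y
      simp only [Function.comp_apply, (hasFDerivAt_expo ξ y).fderiv]
      simp [c, mul_comm]
    rw [h2, iteratedFDeriv_const_smul_apply
      ((contDiff_expo ξ).of_le (by exact_mod_cast le_top)).contDiffAt]
    simp only [smul_apply, ih, smul_eq_mul, Fin.prod_univ_castSucc, Fin.init, c]
    ring

/-- The normalization of D_j cancels the factor -2πi of each derivative, leaving the monomial ξ^α.
-/
theorem diffD_expo (α : Fin d → ℕ) (ξ x : EuclideanSpace ℝ (Fin d)) :
    diffD α (expo ξ) x =
      expo ξ x * ∏ j : Fin (len α), ((ξ (finSigmaFinEquiv.symm j).1 : ℝ) : ℂ) := by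
  rw [diffD, partialD, iteratedFDeriv_expo_apply, Finset.prod_mul_distrib, Finset.prod_const,
    Finset.card_univ, Fintype.card_fin]
  have h1 : (-1 / (2 * Real.pi * Complex.I) : ℂ) ^ len α * (-(2 * Real.pi * Complex.I)) ^ len α
      = 1 := by
    rw [← mul_pow]
    have : (2 * Real.pi * Complex.I : ℂ) ≠ 0 := by
      simp [Real.pi_ne_zero]
    rw [show (-1 / (2 * Real.pi * Complex.I) : ℂ) * (-(2 * Real.pi * Complex.I)) = 1 by
      field_simp, one_pow]
  simp only [EuclideanSpace.inner_single_right, one_mul, conj_trivial]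
  calc _ = ((-1 / (2 * Real.pi * Complex.I) : ℂ) ^ len α * (-(2 * Real.pi * Complex.I)) ^ len α) *
        (expo ξ x * ∏ j : Fin (len α), ((ξ (finSigmaFinEquiv.symm j).1 : ℝ) : ℂ)) := by ring
    _ = _ := by rw [h1, one_mul]

theorem norm_diffD_expo_le (α : Fin d → ℕ) (ξ x : EuclideanSpace ℝ (Fin d)) :
    ‖diffD α (expo ξ) x‖ ≤ ‖ξ‖ ^ len α := by
  rw [diffD_expo, norm_mul, norm_expo, one_mul, norm_prod]
  refine (Finset.prod_le_prod (fun _ _ => norm_nonneg _) (g := fun _ => ‖ξ‖) fun j _ => ?_).trans ?_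
  · rw [Complex.norm_real]
    exact PiLp.norm_apply_le ξ _
  · simp

theorem norm_expo_sub_expo_le (ξ ξ' x : EuclideanSpace ℝ (Fin d)) :
    ‖expo ξ x - expo ξ' x‖ ≤ 2 * Real.pi * ‖x‖ * ‖ξ - ξ'‖ := by
  have h1 : expo ξ x = expo ξ' x * expo (ξ - ξ') x := by
    simp only [expo, ← Complex.exp_add, inner_sub_right]
    congr 1
    push_cast
    ring
  have h2 : expo (ξ - ξ') x =
      Complex.exp (Complex.I * ((-(2 * Real.pi * inner ℝ x (ξ - ξ')) : ℝ) : ℂ)) := by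
    rw [expo]
    congr 1
    push_cast
    ring
  have h3 : expo ξ x - expo ξ' x = expo ξ' x * (expo (ξ - ξ') x - 1) := by rw [h1]; ring
  rw [h3, norm_mul, norm_expo, one_mul, h2]
  refine Real.norm_exp_I_mul_ofReal_sub_one_le.trans ?_
  rw [norm_neg, norm_mul, Real.norm_of_nonneg (by positivity : 0 ≤ 2 * Real.pi),
    mul_assoc (2 * Real.pi)]
  exact mul_le_mul_of_nonneg_left (norm_inner_le_norm (𝕜 := ℝ) x (ξ - ξ'))
    (by positivity : 0 ≤ 2 * Real.pi)

/-- Telescoping. The crude (2R)^n suffices, since geometric factors are absorbed by the weights. -/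
theorem norm_prod_sub_prod_le {n : ℕ} (a b : Fin n → ℂ) {R δ : ℝ} (hR : 1 ≤ R) (hδ : 0 ≤ δ)
    (ha : ∀ j, ‖a j‖ ≤ R) (hb : ∀ j, ‖b j‖ ≤ R) (hab : ∀ j, ‖a j - b j‖ ≤ δ) :
    ‖∏ j, a j - ∏ j, b j‖ ≤ (2 * R) ^ n * δ := by
  induction n with
  | zero => simpa using hδ
  | succ n ih =>
    rw [Fin.prod_univ_succ, Fin.prod_univ_succ]
    have h1 := ih (fun j => a j.succ) (fun j => b j.succ) (fun j => ha _) (fun j => hb _)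
      fun j => hab _
    have h2 : ‖∏ j : Fin n, b j.succ‖ ≤ R ^ n := by
      rw [norm_prod]
      exact (Finset.prod_le_prod (fun _ _ => norm_nonneg _) (g := fun _ => R)
        fun j _ => hb _).trans (by simp)
    have h3 : a 0 * ∏ j : Fin n, a j.succ - b 0 * ∏ j : Fin n, b j.succ =
        a 0 * (∏ j : Fin n, a j.succ - ∏ j : Fin n, b j.succ) +
          (a 0 - b 0) * ∏ j : Fin n, b j.succ := by ring
    have h4 : R ^ n ≤ R * (2 * R) ^ n := by
      have : R ^ n ≤ (2 * R) ^ n := by gcongr; linarith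
      nlinarith [pow_pos (by linarith : 0 < 2 * R) n]
    rw [h3]
    calc _ ≤ ‖a 0‖ * ‖∏ j : Fin n, a j.succ - ∏ j : Fin n, b j.succ‖ +
          ‖a 0 - b 0‖ * ‖∏ j : Fin n, b j.succ‖ := by
            simpa only [norm_mul] using norm_add_le (a 0 * (∏ j : Fin n, a j.succ -
              ∏ j : Fin n, b j.succ)) ((a 0 - b 0) * ∏ j : Fin n, b j.succ)
      _ ≤ R * ((2 * R) ^ n * δ) + δ * R ^ n := by
          gcongr
          · exact ha 0
          · exact hab 0
      _ ≤ R * ((2 * R) ^ n * δ) + δ * (R * (2 * R) ^ n) := by gcongr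
      _ = _ := by ring

theorem norm_diffD_expo_sub_le (α : Fin d → ℕ) {ξ ξ' x : EuclideanSpace ℝ (Fin d)} {R : ℝ}
    (hR : 1 ≤ R) (hξ : ‖ξ‖ ≤ R) (hξ' : ‖ξ'‖ ≤ R) :
    ‖diffD α (expo ξ) x - diffD α (expo ξ') x‖ ≤
      (2 * R) ^ len α * ((1 + 2 * Real.pi * ‖x‖) * ‖ξ - ξ'‖) := by
  simp only [diffD_expo]
  set a : Fin (len α) → ℂ := fun j => ((ξ (finSigmaFinEquiv.symm j).1 : ℝ) : ℂ) with ha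
  set b : Fin (len α) → ℂ := fun j => ((ξ' (finSigmaFinEquiv.symm j).1 : ℝ) : ℂ) with hb
  have haR : ∀ j, ‖a j‖ ≤ R := fun j => by
    rw [ha, Complex.norm_real]; exact (PiLp.norm_apply_le ξ _).trans hξ
  have hbR : ∀ j, ‖b j‖ ≤ R := fun j => by
    rw [hb, Complex.norm_real]; exact (PiLp.norm_apply_le ξ' _).trans hξ'
  have h1 := norm_prod_sub_prod_le a b hR (norm_nonneg (ξ - ξ')) haR hbR fun j => by
    rw [ha, hb, ← Complex.ofReal_sub, Complex.norm_real]
    exact PiLp.norm_apply_le (ξ - ξ') _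
  have h2 : ‖∏ j, b j‖ ≤ (2 * R) ^ len α := by
    rw [norm_prod]
    refine (Finset.prod_le_prod (fun _ _ => norm_nonneg _) (g := fun _ => 2 * R)
        fun j _ => (hbR j).trans (by linarith)).trans (by simp)
  have h3 : expo ξ x * ∏ j, a j - expo ξ' x * ∏ j, b j =
      expo ξ x * (∏ j, a j - ∏ j, b j) + (expo ξ x - expo ξ' x) * ∏ j, b j := by ring
  rw [h3]
  refine (norm_add_le _ _).trans ?_
  rw [norm_mul, norm_mul, norm_expo, one_mul]
  calc _ ≤ (2 * R) ^ len α * ‖ξ - ξ'‖ + 2 * Real.pi * ‖x‖ * ‖ξ - ξ'‖ * (2 * R) ^ len α := by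
        gcongr
        exact norm_expo_sub_expo_le ξ ξ' x
    _ = _ := by ring

end Expo

/-! ### Part (i): growth of the Fourier transform -/

section Growth

variable {d : ℕ} {σ : ℝ}

/-- The Fourier transform of an ultradistribution grows at most like `exp (h * rate σ)`. -/
theorem exists_norm_fourier_le (hσ : 1 < σ) {u : testE d σ →ₗ[ℂ] ℂ} (hu : IsUltradistribution u) :
    ∃ h : ℝ, 0 < h ∧ ∃ C : ℝ, 0 < C ∧ ∀ ξ : EuclideanSpace ℝ (Fin d), 1 < ‖ξ‖ →
      ‖fourier hσ u ξ‖ ≤ C * Real.exp (h * rate σ ‖ξ‖) := by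
  obtain ⟨τ, hτ, K, -, ε, hε, C, hC, hle⟩ := hu
  obtain ⟨h, hh, C', hC', hle'⟩ := exists_pow_le_exp_rate_mul hσ hτ hε
  refine ⟨h, hh, C * C', by positivity, fun ξ hξ => (hle _).trans ?_⟩
  rw [mul_assoc]
  refine mul_le_mul_of_nonneg_left (Real.iSup_le (fun p => ?_) (by positivity)) hC.le
  have := M_pos hσ (τ := τ) (len p.1)
  rw [div_le_iff₀ (by positivity)]
  exact (norm_diffD_expo_le _ _ _).trans (hle' _ _ hξ)

end Growth

/-! ### Factorization of u through a Banach space of jets -/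

section Seminorm

variable {d : ℕ} {σ : ℝ}

theorem diffD_add (α : Fin d → ℕ) {f g : EuclideanSpace ℝ (Fin d) → ℂ} (hf : ContDiff ℝ ∞ f)
    (hg : ContDiff ℝ ∞ g) (x : EuclideanSpace ℝ (Fin d)) :
    diffD α (f + g) x = diffD α f x + diffD α g x := by
  unfold diffD partialD
  rw [iteratedFDeriv_add_apply (hf.of_le (by exact_mod_cast le_top)).contDiffAt
    (hg.of_le (by exact_mod_cast le_top)).contDiffAt, ← mul_add]
  rfl

theorem diffD_smul (α : Fin d → ℕ) (c : ℂ) {f : EuclideanSpace ℝ (Fin d) → ℂ}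
    (hf : ContDiff ℝ ∞ f) (x : EuclideanSpace ℝ (Fin d)) :
    diffD α (c • f) x = c * diffD α f x := by
  unfold diffD partialD
  rw [iteratedFDeriv_const_smul_apply (hf.of_le (by exact_mod_cast le_top)).contDiffAt]
  simp only [smul_apply, smul_eq_mul]
  ring

theorem contDiff_of_mem_testE {φ : EuclideanSpace ℝ (Fin d) → ℂ} (hφ : φ ∈ testE d σ) :
    ContDiff ℝ ∞ φ := by
  simp only [testE, Submodule.mem_iInf] at hφ
  exact (hφ 1 one_pos).1

open scoped ENNReal in
/-- The weighted family of all derivatives of a test function on a compact set. -/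
noncomputable def jet (hσ : 1 < σ) {τ : ℝ} (hτ : 0 < τ) {K : Set (EuclideanSpace ℝ (Fin d))}
    (hK : IsCompact K) {ε : ℝ} (hε : 0 < ε) :
    testE d σ →ₗ[ℂ] lp (fun _ : (Fin d → ℕ) × K => ℂ) ∞ where
  toFun φ := ⟨fun p => diffD p.1 (φ : EuclideanSpace ℝ (Fin d) → ℂ) p.2 /
      ((ε ^ ((len p.1 : ℝ) ^ σ) * M τ σ (len p.1) : ℝ) : ℂ), by
    refine memℓp_infty ((bddAbove_of_mem_testE hσ φ hτ hK hε).mono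
      (Set.range_subset_range_iff_exists_comp.2 ⟨id, ?_⟩))
    funext p
    have := M_pos hσ (τ := τ) (len p.1)
    simp only [Function.comp_id, norm_div, Complex.norm_real]
    rw [Real.norm_of_nonneg (by positivity)]⟩
  map_add' φ ψ := by
    ext p
    change diffD p.1 ((φ : EuclideanSpace ℝ (Fin d) → ℂ) + ψ) p.2 / _ = diffD p.1 φ p.2 / _ +
      diffD p.1 ψ p.2 / _
    rw [diffD_add _ (contDiff_of_mem_testE φ.2) (contDiff_of_mem_testE ψ.2), add_div]
  map_smul' c φ := by
    ext p
    change diffD p.1 (c • (φ : EuclideanSpace ℝ (Fin d) → ℂ)) p.2 / _ =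
      c * (diffD p.1 φ p.2 / _)
    rw [diffD_smul _ _ (contDiff_of_mem_testE φ.2), mul_div_assoc]

variable (hσ : 1 < σ) {τ : ℝ} (hτ : 0 < τ) {K : Set (EuclideanSpace ℝ (Fin d))}
    (hK : IsCompact K) {ε : ℝ} (hε : 0 < ε)

theorem jet_apply (φ : testE d σ) (p : (Fin d → ℕ) × K) :
    jet hσ hτ hK hε φ p = diffD p.1 (φ : EuclideanSpace ℝ (Fin d) → ℂ) p.2 /
      ((ε ^ ((len p.1 : ℝ) ^ σ) * M τ σ (len p.1) : ℝ) : ℂ) := rfl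

theorem norm_jet_apply (φ : testE d σ) (p : (Fin d → ℕ) × K) :
    ‖jet hσ hτ hK hε φ p‖ = ‖diffD p.1 (φ : EuclideanSpace ℝ (Fin d) → ℂ) p.2‖ /
      (ε ^ ((len p.1 : ℝ) ^ σ) * M τ σ (len p.1)) := by
  have := M_pos hσ (τ := τ) (len p.1)
  rw [jet_apply, norm_div, Complex.norm_real, Real.norm_of_nonneg (by positivity)]

theorem norm_jet (φ : testE d σ) :
    ‖jet hσ hτ hK hε φ‖ = ⨆ p : (Fin d → ℕ) × K,
      ‖diffD p.1 (φ : EuclideanSpace ℝ (Fin d) → ℂ) p.2‖ /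
        (ε ^ ((len p.1 : ℝ) ^ σ) * M τ σ (len p.1)) := by
  rw [lp.norm_eq_ciSup]
  simp only [norm_jet_apply]

theorem norm_jet_le {φ : testE d σ} {B : ℝ} (hB : 0 ≤ B)
    (h : ∀ (α : Fin d → ℕ), ∀ x ∈ K, ‖diffD α (φ : EuclideanSpace ℝ (Fin d) → ℂ) x‖ ≤
      B * (ε ^ ((len α : ℝ) ^ σ) * M τ σ (len α))) : ‖jet hσ hτ hK hε φ‖ ≤ B := by
  rw [norm_jet]
  refine Real.iSup_le (fun p => ?_) hB
  have := M_pos hσ (τ := τ) (len p.1)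
  rw [div_le_iff₀ (by positivity)]
  exact h p.1 p.2 p.2.2

/-- A functional dominated by a norm pulled back along `J` factors through `J`. -/
theorem exists_clm_comp_eq {V B : Type*} [AddCommGroup V] [Module ℂ V] [NormedAddCommGroup B]
    [NormedSpace ℂ B] (J : V →ₗ[ℂ] B) (u : V →ₗ[ℂ] ℂ) {C : ℝ} (hC : 0 ≤ C)
    (h : ∀ v, ‖u v‖ ≤ C * ‖J v‖) : ∃ U : B →L[ℂ] ℂ, ∀ v, U (J v) = u v := by
  obtain ⟨g, hg⟩ := J.rangeRestrict.exists_rightInverse_of_surjective J.range_rangeRestrict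
  have hg' : ∀ y : LinearMap.range J, J (g y) = y := fun y =>
    congrArg Subtype.val (LinearMap.congr_fun hg y)
  obtain ⟨U, hU, hUle⟩ := Module.Dual.exists_extension_of_le_seminorm (LinearMap.range J)
    (u ∘ₗ g) (p := C.toNNReal • normSeminorm ℂ B) fun y => by
      have := h (g y)
      rw [hg'] at this
      simpa [NNReal.smul_def, hC] using this
  refine ⟨U.mkContinuous C fun x => by simpa [NNReal.smul_def, hC] using hUle x, fun v => ?_⟩
  have h1 := hU ⟨J v, v, rfl⟩
  refine h1.trans ?_
  -- The preimage chosen by `g` need not be v, but the two have the same image under J, and the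
  -- bound makes u vanish on the kernel of J.
  have h2 := h (g ⟨J v, v, rfl⟩ - v)
  rw [map_sub, map_sub, hg', sub_self, norm_zero, mul_zero] at h2
  exact sub_eq_zero.1 (norm_le_zero_iff.1 h2)

/-- Locally Lipschitz, because the weights absorb (2R)^n uniformly in n. This makes û continuous and
the Bochner integrand below measurable. -/
theorem continuous_jet_expo :
    Continuous fun ξ => jet hσ hτ hK hε ⟨expo ξ, expo_mem_testE hσ ξ⟩ := by
  obtain ⟨B, hB⟩ := hK.exists_bound_of_continuousOn (f := id) continuousOn_id
  rw [continuous_iff_continuousAt]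
  intro ξ₀
  set R := ‖ξ₀‖ + 1 with hR
  have hR1 : 1 ≤ R := by linarith [norm_nonneg ξ₀]
  obtain ⟨A, hA, hle⟩ := pow_le_M (by linarith : 1 ≤ 2 * R) hτ hσ hε
  have hB' : 0 ≤ 1 + 2 * Real.pi * |B| := by positivity
  refine ContinuousOn.continuousAt (s := Metric.ball ξ₀ 1) ?_ (Metric.ball_mem_nhds _ one_pos)
  have hball : ∀ ξ ∈ Metric.ball ξ₀ 1, ‖ξ‖ ≤ R := fun ξ hξ => by
    have h1 := norm_le_norm_add_norm_sub' ξ ξ₀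
    rw [Metric.mem_ball, dist_eq_norm] at hξ
    linarith
  refine LipschitzOnWith.continuousOn (K := (A * (1 + 2 * Real.pi * |B|)).toNNReal)
    (LipschitzOnWith.of_dist_le_mul fun ξ hξ ξ' hξ' => ?_)
  rw [dist_eq_norm, dist_eq_norm, ← map_sub, Real.coe_toNNReal _ (by positivity)]
  refine norm_jet_le hσ hτ hK hε (by positivity) fun α x hx => ?_
  have h1 : diffD α (expo ξ - expo ξ') x = diffD α (expo ξ) x - diffD α (expo ξ') x := by
    have h2 : expo ξ - expo ξ' = expo ξ + (-1 : ℂ) • expo ξ' := by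
      funext y; simp [sub_eq_add_neg]
    have h3 : ContDiff ℝ ∞ ((-1 : ℂ) • expo ξ') := (contDiff_expo ξ').const_smul (-1 : ℂ)
    rw [h2, diffD_add _ (contDiff_expo ξ) h3, diffD_smul _ _ (contDiff_expo ξ')]
    ring
  have hxB : ‖x‖ ≤ |B| := (hB x hx).trans (le_abs_self B)
  calc ‖diffD α (expo ξ - expo ξ') x‖
      ≤ (2 * R) ^ len α * ((1 + 2 * Real.pi * ‖x‖) * ‖ξ - ξ'‖) := by
        rw [h1]; exact norm_diffD_expo_sub_le α hR1 (hball ξ hξ) (hball ξ' hξ')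
    _ ≤ (A * ε ^ ((len α : ℝ) ^ σ) * M τ σ (len α)) *
        ((1 + 2 * Real.pi * |B|) * ‖ξ - ξ'‖) := by
        have := M_pos hσ (τ := τ) (len α)
        gcongr
        exact hle _
    _ = _ := by ring

end Seminorm

open MeasureTheory
open scoped FourierTransform

/-! ### Fourier transform between decay and ultradifferentiability -/

section RapidDecay

variable {d : ℕ} {σ : ℝ}

/-- Functions whose decay at infinity is governed by all the weights `M τ σ`, `τ > 0`. -/
def RapidDecay (σ : ℝ) (ψ : EuclideanSpace ℝ (Fin d) → ℂ) : Prop :=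
  ∀ τ : ℝ, 0 < τ → ∃ C : ℝ, 0 < C ∧ ∀ (n : ℕ) (ξ : EuclideanSpace ℝ (Fin d)),
    ‖ξ‖ ^ n * ‖ψ ξ‖ ≤ C * M τ σ n

theorem RapidDecay.comp_neg {ψ : EuclideanSpace ℝ (Fin d) → ℂ} (hψ : RapidDecay σ ψ) :
    RapidDecay σ fun ξ => ψ (-ξ) := by
  intro τ hτ
  obtain ⟨C, hC, hle⟩ := hψ τ hτ
  exact ⟨C, hC, fun n ξ => by simpa using hle n (-ξ)⟩

theorem RapidDecay.exists_le_rpow (hσ : 1 < σ) {ψ : EuclideanSpace ℝ (Fin d) → ℂ}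
    (hψ : RapidDecay σ ψ) {τ : ℝ} (hτ : 0 < τ) : ∃ C : ℝ, 0 < C ∧ ∀ n ξ,
      ‖ξ‖ ^ n * ‖ψ ξ‖ ≤ C * M τ σ n * (1 + ‖ξ‖) ^ (-(d + 1 : ℝ)) := by
  -- Integrability needs d + 1 further powers of |ξ|; a smaller τ' pays for the shift of the index.
  obtain ⟨τ', hτ', A, hA, hleA⟩ := exists_M_add_le hσ hτ (d + 1)
  obtain ⟨C₀, hC₀, hle₀⟩ := hψ τ hτ
  obtain ⟨C₁, hC₁, hle₁⟩ := hψ τ' hτ'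
  refine ⟨2 ^ (d + 1) * (C₀ + C₁ * A), by positivity, fun n ξ => ?_⟩
  have hpos : 0 < 1 + ‖ξ‖ := by positivity
  rw [Real.rpow_neg hpos.le, ← div_eq_mul_inv, le_div_iff₀ (by positivity),
    show (d + 1 : ℝ) = ((d + 1 : ℕ) : ℝ) by push_cast; ring, Real.rpow_natCast]
  have h1 : (1 + ‖ξ‖) ^ (d + 1) ≤ 2 ^ (d + 1) * (1 + ‖ξ‖ ^ (d + 1)) := by
    have h2 : 1 + ‖ξ‖ ≤ 2 * max 1 ‖ξ‖ := by
      linarith [le_max_left 1 ‖ξ‖, le_max_right 1 ‖ξ‖]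
    calc _ ≤ (2 * max 1 ‖ξ‖) ^ (d + 1) := by gcongr
      _ = 2 ^ (d + 1) * (max 1 ‖ξ‖) ^ (d + 1) := mul_pow _ _ _
      _ ≤ _ := by
        gcongr
        rcases max_cases 1 ‖ξ‖ with ⟨h, -⟩ | ⟨h, -⟩ <;> rw [h]
        · rw [one_pow]; linarith [pow_nonneg (norm_nonneg ξ) (d + 1)]
        · linarith
  have h3 := hle₀ n ξ
  have h4 := hle₁ (n + (d + 1)) ξ
  have h5 := mul_le_mul_of_nonneg_left (hleA n) hC₁.le
  rw [pow_add] at h4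
  calc _ ≤ ‖ξ‖ ^ n * ‖ψ ξ‖ * (2 ^ (d + 1) * (1 + ‖ξ‖ ^ (d + 1))) := by gcongr
    _ = 2 ^ (d + 1) * (‖ξ‖ ^ n * ‖ψ ξ‖ + ‖ξ‖ ^ n * ‖ξ‖ ^ (d + 1) * ‖ψ ξ‖) := by ring
    _ ≤ 2 ^ (d + 1) * (C₀ * M τ σ n + C₁ * (A * M τ σ n)) := by
      exact mul_le_mul_of_nonneg_left (add_le_add h3 (h4.trans h5)) (by positivity)
    _ = _ := by ring

theorem integrable_one_add_norm_rpow :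
    Integrable fun ξ : EuclideanSpace ℝ (Fin d) => (1 + ‖ξ‖) ^ (-(d + 1 : ℝ)) :=
  integrable_one_add_norm (by simp)

theorem RapidDecay.integrable_pow_mul (hσ : 1 < σ) {ψ : EuclideanSpace ℝ (Fin d) → ℂ}
    (hψ : RapidDecay σ ψ) (hc : Continuous ψ) (n : ℕ) :
    Integrable fun ξ => ‖ξ‖ ^ n * ‖ψ ξ‖ := by
  obtain ⟨C, hC, hle⟩ := hψ.exists_le_rpow hσ one_pos
  refine (integrable_one_add_norm_rpow.const_mul (C * M 1 σ n)).mono'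
    (by fun_prop : Continuous fun ξ => ‖ξ‖ ^ n * ‖ψ ξ‖).aestronglyMeasurable
    (Eventually.of_forall fun ξ => ?_)
  rw [Real.norm_of_nonneg (by positivity)]
  exact hle n ξ

theorem RapidDecay.integrable (hσ : 1 < σ) {ψ : EuclideanSpace ℝ (Fin d) → ℂ}
    (hψ : RapidDecay σ ψ) (hc : Continuous ψ) : Integrable ψ := by
  have h := hψ.integrable_pow_mul hσ hc 0
  simp only [pow_zero, one_mul] at h
  exact (integrable_norm_iff hc.aestronglyMeasurable).1 h

theorem RapidDecay.ultraDiff_fourier (hσ : 1 < σ) {ψ : EuclideanSpace ℝ (Fin d) → ℂ}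
    (hψ : RapidDecay σ ψ) (hc : Continuous ψ) : UltraDiff σ (𝓕 ψ) := by
  have hint := hψ.integrable_pow_mul hσ hc
  refine ⟨Real.contDiff_fourier fun n _ => hint n, fun K _ τ hτ => ?_⟩
  obtain ⟨C, hC, hle⟩ := hψ.exists_le_rpow hσ (half_pos hτ)
  obtain ⟨A, hA, hleA⟩ := exists_pow_le_M hσ (half_pos hτ)
    (2 * Real.pi * ‖innerSL ℝ (E := EuclideanSpace ℝ (Fin d))‖)
  set I := ∫ ξ : EuclideanSpace ℝ (Fin d), (1 + ‖ξ‖) ^ (-(d + 1 : ℝ)) with hI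
  have hI0 : 0 ≤ I := integral_nonneg fun ξ => by positivity
  refine ⟨A * C * (I + 1), by positivity, fun x _ n => ?_⟩
  have hM := M_pos hσ (τ := τ / 2) n
  have h1 : ∫ ξ, ‖ξ‖ ^ n * ‖ψ ξ‖ ≤ C * M (τ / 2) σ n * I := by
    rw [hI, ← integral_const_mul]
    exact integral_mono (hint n) (integrable_one_add_norm_rpow.const_mul _) (hle n)
  have h2 := hleA n
  rw [abs_of_nonneg (by positivity)] at h2
  rw [Real.iteratedFDeriv_fourier (N := ⊤) (fun n _ => hint n) hc.aestronglyMeasurable le_top]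
  refine (VectorFourier.norm_fourierIntegral_le_integral_norm _ _ _ _ _).trans ?_
  calc _ ≤ ∫ ξ, (2 * Real.pi * ‖innerSL ℝ (E := EuclideanSpace ℝ (Fin d))‖) ^ n *
        (‖ξ‖ ^ n * ‖ψ ξ‖) := by
        refine integral_mono_of_nonneg (Eventually.of_forall fun _ => norm_nonneg _)
          ((hint n).const_mul _) (Eventually.of_forall fun ξ => ?_)
        have := VectorFourier.norm_fourierPowSMulRight_le
          (innerSL ℝ (E := EuclideanSpace ℝ (Fin d))) ψ ξ n
        rwa [mul_assoc] at this
    _ = (2 * Real.pi * ‖innerSL ℝ (E := EuclideanSpace ℝ (Fin d))‖) ^ n *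
        ∫ ξ, ‖ξ‖ ^ n * ‖ψ ξ‖ := integral_const_mul _ _
    _ ≤ (A * M (τ / 2) σ n) * (C * M (τ / 2) σ n * I) := by
        gcongr
    _ = A * C * I * (M (τ / 2) σ n * M (τ / 2) σ n) := by ring
    _ = A * C * I * M τ σ n := by rw [M_mul_M hσ, add_halves]
    _ ≤ _ := by
        have := M_pos hσ (τ := τ) n
        gcongr
        linarith

theorem RapidDecay.ultraDiff_fourierInv (hσ : 1 < σ) {ψ : EuclideanSpace ℝ (Fin d) → ℂ}
    (hψ : RapidDecay σ ψ) (hc : Continuous ψ) : UltraDiff σ (𝓕⁻ ψ) := by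
  rw [Real.fourierInv_eq_fourier_comp_neg]
  exact hψ.comp_neg.ultraDiff_fourier hσ (hc.comp continuous_neg)

theorem M_mono_right (hσ : 1 < σ) {τ : ℝ} (hτ : 0 ≤ τ) {m n : ℕ} (h : m ≤ n) :
    M τ σ m ≤ M τ σ n := by
  obtain ⟨k, rfl⟩ := Nat.exists_eq_add_of_le h
  exact (le_mul_of_one_le_right (M_pos hσ m).le (one_le_M hσ hτ k)).trans
    (M_mul_M_le_M_add hσ hτ m k)

/-- Powers of the frequency become derivatives of φ, whose L¹ norms are bounded by the supremum on
the support times its volume. -/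
theorem UltraDiff.rapidDecay_fourier (hσ : 1 < σ) {φ : EuclideanSpace ℝ (Fin d) → ℂ}
    (hφ : UltraDiff σ φ) (hs : HasCompactSupport φ) : RapidDecay σ (𝓕 φ) := by
  intro τ hτ
  obtain ⟨C, hC, hle⟩ := hφ.2 _ hs (τ / 2) (half_pos hτ)
  obtain ⟨A, hA, hleA⟩ := exists_pow_le_M hσ (half_pos hτ) 4
  set V := (volume : Measure (EuclideanSpace ℝ (Fin d))).real (tsupport φ)
  have hcont : ∀ n : ℕ, Continuous (iteratedFDeriv ℝ n φ) := fun n =>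
    hφ.1.continuous_iteratedFDeriv (by exact_mod_cast le_top)
  have hint : ∀ n, ∫ v, ‖iteratedFDeriv ℝ n φ v‖ ≤ C * M (τ / 2) σ n * V := by
    intro n
    have h1 : ∫ v in tsupport φ, ‖iteratedFDeriv ℝ n φ v‖ = ∫ v, ‖iteratedFDeriv ℝ n φ v‖ :=
      setIntegral_eq_integral_of_forall_compl_eq_zero fun x hx => by
        rw [norm_eq_zero]
        by_contra h
        exact hx (support_iteratedFDeriv_subset n h)
    rw [← h1]
    refine (Real.le_norm_self _).trans (norm_setIntegral_le_of_norm_le_const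
      (IsCompact.measure_lt_top hs) fun x hx => ?_)
    rw [norm_norm]
    exact hle x hx n
  refine ⟨A * C * (V + 1), by positivity, fun n w => ?_⟩
  have h1 := Real.pow_mul_norm_iteratedFDeriv_fourier_le (f := φ) (K := ⊤) (N := ⊤) hφ.1
    (fun k n _ _ => by
      refine Continuous.integrable_of_hasCompactSupport (by have := hcont n; fun_prop) ?_
      exact (hs.iteratedFDeriv n).norm.mul_left) (k := 0) (n := n) le_top le_top w
  simp only [norm_iteratedFDeriv_zero] at h1
  have hM := M_pos hσ (τ := τ / 2) n
  have hterm : ∀ p ∈ Finset.range (0 + 1) ×ˢ Finset.range (n + 1),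
      ∫ v, ‖v‖ ^ p.1 * ‖iteratedFDeriv ℝ p.2 φ v‖ ≤ C * M (τ / 2) σ n * V := by
    rintro ⟨i, j⟩ hp
    simp only [zero_add, Finset.mem_product, Finset.mem_range, Nat.lt_one_iff] at hp
    obtain ⟨rfl, hj⟩ := hp
    simp only [pow_zero, one_mul]
    refine (hint j).trans ?_
    gcongr
    exact M_mono_right hσ (half_pos hτ).le (by omega)
  refine h1.trans ((mul_le_mul_of_nonneg_left (Finset.sum_le_sum hterm) (by positivity)).trans ?_)
  rw [Finset.sum_const, nsmul_eq_mul]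
  have h2 : (((Finset.range (0 + 1) ×ˢ Finset.range (n + 1)).card : ℕ) : ℝ) ≤ 2 ^ n := by
    have : n + 1 ≤ 2 ^ n := Nat.lt_two_pow_self
    simpa using (by exact_mod_cast this : ((n + 1 : ℕ) : ℝ) ≤ 2 ^ n)
  have h3 := hleA n
  rw [abs_of_pos (by norm_num)] at h3
  have hV : 0 ≤ V := measureReal_nonneg
  calc _ ≤ (2 * Real.pi) ^ 0 * (2 * (0 : ℕ) + 2) ^ n * (2 ^ n * (C * M (τ / 2) σ n * V)) := by
        gcongr
    _ = 4 ^ n * (C * M (τ / 2) σ n * V) := by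
        have h4 : (2 : ℝ) ^ n * 2 ^ n = 4 ^ n := by rw [← mul_pow]; norm_num
        rw [← h4, Nat.cast_zero, mul_zero, zero_add, pow_zero, one_mul]
        ring
    _ ≤ (A * M (τ / 2) σ n) * (C * M (τ / 2) σ n * (V + 1)) := by
        gcongr
        linarith
    _ = A * C * (V + 1) * (M (τ / 2) σ n * M (τ / 2) σ n) := by ring
    _ = _ := by rw [M_mul_M hσ, add_halves]

theorem UltraDiff.rapidDecay_fourierInv (hσ : 1 < σ) {φ : EuclideanSpace ℝ (Fin d) → ℂ}
    (hφ : UltraDiff σ φ) (hs : HasCompactSupport φ) : RapidDecay σ (𝓕⁻ φ) := by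
  have h := (hφ.rapidDecay_fourier hσ hs).comp_neg
  have e : 𝓕⁻ φ = fun ξ => 𝓕 φ (-ξ) := funext fun ξ => Real.fourierInv_eq_fourier_neg φ ξ
  rwa [e]

end RapidDecay

/-! ### u applied to a superposition of exponentials -/

section Pairing

variable {d : ℕ} {σ : ℝ}

theorem fourier_eq_integral_expo (ψ : EuclideanSpace ℝ (Fin d) → ℂ)
    (x : EuclideanSpace ℝ (Fin d)) : 𝓕 ψ x = ∫ ξ, ψ ξ * expo ξ x := by
  rw [Real.fourier_eq']
  refine integral_congr_ae (Eventually.of_forall fun ξ => ?_)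
  simp only [smul_eq_mul, expo]
  rw [mul_comm, real_inner_comm]
  congr 2
  push_cast
  ring

theorem expo_symm (ξ x : EuclideanSpace ℝ (Fin d)) : expo ξ x = expo x ξ := by
  rw [expo, expo, real_inner_comm]

theorem diffD_fourier (hσ : 1 < σ) {ψ : EuclideanSpace ℝ (Fin d) → ℂ} (hψ : RapidDecay σ ψ)
    (hc : Continuous ψ) (α : Fin d → ℕ) (x : EuclideanSpace ℝ (Fin d)) :
    diffD α (𝓕 ψ) x = ∫ ξ, ψ ξ * diffD α (expo ξ) x := by
  have hint := hψ.integrable_pow_mul hσ hc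
  unfold diffD partialD
  rw [Real.iteratedFDeriv_fourier (N := ⊤) (fun n _ => hint n) hc.aestronglyMeasurable le_top]
  rw [Real.fourier_continuousMultilinearMap_apply (by
    exact VectorFourier.integrable_fourierPowSMulRight _ (hint _) hc.aestronglyMeasurable)]
  rw [fourier_eq_integral_expo, ← integral_const_mul]
  refine integral_congr_ae (Eventually.of_forall fun ξ => ?_)
  have happly : ∀ v : Fin (len α) → EuclideanSpace ℝ (Fin d),
      VectorFourier.fourierPowSMulRight (innerSL ℝ) ψ ξ (len α) v =
        (-(2 * Real.pi * Complex.I)) ^ len α • (∏ i, inner ℝ ξ (v i)) • ψ ξ := fun v =>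
    VectorFourier.fourierPowSMulRight_apply _
  simp only [happly, iteratedFDeriv_expo_apply,
    Finset.prod_mul_distrib, Finset.prod_const, Finset.card_univ, Fintype.card_fin, smul_eq_mul,
    Complex.real_smul, Complex.ofReal_prod]
  ring

/-- A continuous functional commutes with the superposition of exponentials. -/
theorem apply_fourier_eq_integral (hσ : 1 < σ) {u : testE d σ →ₗ[ℂ] ℂ}
    (hu : IsUltradistribution u) {ψ : EuclideanSpace ℝ (Fin d) → ℂ} (hψ : RapidDecay σ ψ)
    (hc : Continuous ψ) (hmem : 𝓕 ψ ∈ testE d σ) :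
    u ⟨𝓕 ψ, hmem⟩ = ∫ ξ, ψ ξ * fourier hσ u ξ := by
  obtain ⟨τ, hτ, K, hK, ε, hε, C, hC, hle⟩ := hu
  let J := jet hσ hτ hK hε
  obtain ⟨U, hU⟩ := exists_clm_comp_eq J u hC.le fun φ => by
    rw [norm_jet hσ hτ hK hε]; exact hle φ
  obtain ⟨A, hA, hleA⟩ := exists_one_le_rpow_mul_M hσ (half_pos hτ) hε
  obtain ⟨B, hB, hleB⟩ := hψ.exists_le_rpow hσ (half_pos hτ)
  -- The integral of Φ is taken in the ℓ^∞ space of jets: half of τ controls the decay of ψ, the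
  -- other half the powers of ε.
  let Φ := fun ξ => ψ ξ • J ⟨expo ξ, expo_mem_testE hσ ξ⟩
  have hΦc : Continuous Φ := hc.smul (continuous_jet_expo hσ hτ hK hε)
  have hΦ : Integrable Φ := by
    refine (integrable_one_add_norm_rpow.const_mul (B * A)).mono' hΦc.aestronglyMeasurable
      (Eventually.of_forall fun ξ => ?_)
    have hsm : Φ ξ = J (ψ ξ • ⟨expo ξ, expo_mem_testE hσ ξ⟩) := (map_smul _ _ _).symm
    rw [hsm]
    refine norm_jet_le hσ hτ hK hε (by positivity) fun α x _ => ?_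
    change ‖diffD α (ψ ξ • expo ξ) x‖ ≤ _
    rw [diffD_smul _ _ (contDiff_expo ξ), norm_mul]
    have hM := M_pos hσ (τ := τ / 2) (len α)
    calc _ ≤ ‖ψ ξ‖ * ‖ξ‖ ^ len α := by gcongr; exact norm_diffD_expo_le _ _ _
      _ = ‖ξ‖ ^ len α * ‖ψ ξ‖ := mul_comm _ _
      _ ≤ B * M (τ / 2) σ (len α) * (1 + ‖ξ‖) ^ (-(d + 1 : ℝ)) * 1 := by
          rw [mul_one]; exact hleB _ _
      _ ≤ B * M (τ / 2) σ (len α) * (1 + ‖ξ‖) ^ (-(d + 1 : ℝ)) *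
          (A * (ε ^ ((len α : ℝ) ^ σ) * M (τ / 2) σ (len α))) := by gcongr; exact hleA _
      _ = B * A * (1 + ‖ξ‖) ^ (-(d + 1 : ℝ)) *
          (ε ^ ((len α : ℝ) ^ σ) * (M (τ / 2) σ (len α) * M (τ / 2) σ (len α))) := by ring
      _ = _ := by rw [M_mul_M hσ, add_halves]
  -- Checked coordinate by coordinate, where it is differentiation under the integral sign.
  have hJ : J ⟨𝓕 ψ, hmem⟩ = ∫ ξ, Φ ξ := by
    ext p
    have h1 := (lp.evalCLM (𝕜 := ℂ) (fun _ : (Fin d → ℕ) × K => ℂ) ⊤ p).integral_comp_comm hΦ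
    refine Eq.trans ?_ h1
    rw [jet_apply]
    simp only [diffD_fourier hσ hψ hc, ← integral_div]
    refine integral_congr_ae (Eventually.of_forall fun ξ => ?_)
    exact mul_div_assoc _ _ _
  rw [← hU, hJ, ← U.integral_comp_comm hΦ]
  refine integral_congr_ae (Eventually.of_forall fun ξ => ?_)
  simp only [Φ, map_smul, hU, smul_eq_mul]
  rfl

theorem continuous_fourier (hσ : 1 < σ) {u : testE d σ →ₗ[ℂ] ℂ} (hu : IsUltradistribution u) :
    Continuous (fourier hσ u) := by
  obtain ⟨τ, hτ, K, hK, ε, hε, C, hC, hle⟩ := hu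
  obtain ⟨U, hU⟩ := exists_clm_comp_eq (jet hσ hτ hK hε) u hC.le fun φ => by
    rw [norm_jet hσ hτ hK hε]; exact hle φ
  have h := U.continuous.comp (continuous_jet_expo hσ hτ hK hε)
  refine h.congr fun ξ => ?_
  rw [Function.comp_apply, hU]
  rfl

end Pairing

/-! ### Part (ii): decay implies regularity -/

section Regularity

variable {d : ℕ} {σ : ℝ}

/-- The decay assumption on the Fourier transform in terms of the weights. -/
theorem rapidDecay_of_le_exp_neg_rate (hσ : 1 < σ) {ψ : EuclideanSpace ℝ (Fin d) → ℂ}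
    (hc : Continuous ψ)
    (hψ : ∀ h : ℝ, 0 < h → ∃ C : ℝ, 0 < C ∧ ∃ R : ℝ, ∀ ξ : EuclideanSpace ℝ (Fin d), R ≤ ‖ξ‖ →
      ‖ψ ξ‖ ≤ C * Real.exp (-h * rate σ ‖ξ‖)) : RapidDecay σ ψ := by
  intro τ hτ
  obtain ⟨h, hh, hrate⟩ := exists_pow_mul_exp_neg_rate_le hσ hτ
  obtain ⟨C, hC, R, hle⟩ := hψ h hh
  -- On this ball the decay is not available, but ψ is bounded and the powers of the radius are
  -- absorbed.
  obtain ⟨B, hB⟩ := (isCompact_closedBall (0 : EuclideanSpace ℝ (Fin d))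
    (max R 1)).exists_bound_of_continuousOn hc.continuousOn
  obtain ⟨A, hA, hleA⟩ := exists_pow_le_M hσ hτ (max R 1)
  have hR0 : 0 < max R 1 := lt_max_of_lt_right one_pos
  refine ⟨C + A * |B|, by positivity, fun n ξ => ?_⟩
  have hM := M_pos hσ (τ := τ) n
  rcases le_or_gt ‖ξ‖ (max R 1) with hξ | hξ
  · have h1 : ‖ψ ξ‖ ≤ |B| := (hB ξ (by simpa using hξ)).trans (le_abs_self B)
    have h2 := hleA n
    rw [abs_of_pos hR0] at h2
    calc _ ≤ (max R 1) ^ n * |B| := by gcongr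
      _ ≤ A * M τ σ n * |B| := by gcongr
      _ ≤ (C + A * |B|) * M τ σ n := by nlinarith [mul_pos hC hM]
  · have h1 := hle ξ ((le_max_left R 1).trans hξ.le)
    have h2 := hrate n ‖ξ‖ ((le_max_right R 1).trans_lt hξ)
    calc _ ≤ ‖ξ‖ ^ n * (C * Real.exp (-h * rate σ ‖ξ‖)) := by gcongr
      _ = C * (‖ξ‖ ^ n * Real.exp (-h * rate σ ‖ξ‖)) := by ring
      _ ≤ C * M τ σ n := by gcongr
      _ ≤ (C + A * |B|) * M τ σ n := by
        have : 0 ≤ A * |B| := by positivity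
        gcongr
        linarith

theorem integral_fourierInv_mul {φ ψ : EuclideanSpace ℝ (Fin d) → ℂ} (hφ : Integrable φ)
    (hψ : Integrable ψ) : ∫ ξ, 𝓕⁻ φ ξ * ψ ξ = ∫ x, 𝓕⁻ ψ x * φ x := by
  have h1 : ∫ ξ, 𝓕⁻ φ ξ * ψ ξ = ∫ ξ, 𝓕 φ ξ * ψ (-ξ) := by
    rw [← integral_neg_eq_self]
    simp only [Real.fourierInv_eq_fourier_neg, neg_neg]
  have h2 : ∫ ξ, 𝓕 φ ξ • ψ (-ξ) = ∫ x, φ x • 𝓕 (fun ξ => ψ (-ξ)) x := by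
    have := VectorFourier.integral_fourierIntegral_smul_eq_flip
      (L := innerₗ (EuclideanSpace ℝ (Fin d)))
      Real.continuous_fourierChar continuous_inner hφ (hψ.comp_neg)
    rwa [flip_innerₗ] at this
  rw [h1, Real.fourierInv_eq_fourier_comp_neg]
  simp only [smul_eq_mul] at h2
  rw [h2]
  simp only [mul_comm]

variable {u : testE d σ →ₗ[ℂ] ℂ}

/-- The representation formula on compactly supported test functions. -/
theorem apply_eq_integral_of_hasCompactSupport (hσ : 1 < σ) (hu : IsUltradistribution u)
    (hd : RapidDecay σ (fourier hσ u)) (φ : testE d σ)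
    (hs : HasCompactSupport (φ : EuclideanSpace ℝ (Fin d) → ℂ)) :
    u φ = ∫ x, 𝓕⁻ (fourier hσ u) x * (φ : EuclideanSpace ℝ (Fin d) → ℂ) x := by
  obtain ⟨φ, hφ⟩ := φ
  simp only at hs ⊢
  have hu' := (mem_testE_iff hσ).1 hφ
  have hcφ : Continuous φ := hu'.1.continuous
  have hiφ : Integrable φ := hcφ.integrable_of_hasCompactSupport hs
  have hrd := hu'.rapidDecay_fourierInv hσ hs
  have hcF : Continuous (𝓕 φ) :=
    VectorFourier.fourierIntegral_continuous Real.continuous_fourierChar continuous_inner hiφ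
  have hcI : Continuous (𝓕⁻ φ) := by
    have e : 𝓕⁻ φ = fun ξ => 𝓕 φ (-ξ) := funext fun ξ => Real.fourierInv_eq_fourier_neg φ ξ
    rw [e]
    exact hcF.comp continuous_neg
  have hinv : 𝓕 (𝓕⁻ φ) = φ := hcφ.fourier_fourierInv_eq hiφ
    ((hu'.rapidDecay_fourier hσ hs).integrable hσ hcF)
  have hmem : 𝓕 (𝓕⁻ φ) ∈ testE d σ := by rw [hinv]; exact hφ
  have h1 := apply_fourier_eq_integral hσ hu hrd hcI hmem
  have h2 : (⟨𝓕 (𝓕⁻ φ), hmem⟩ : testE d σ) = ⟨φ, hφ⟩ := Subtype.ext hinv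
  rw [← h2, h1, integral_fourierInv_mul hiφ (hd.integrable hσ (continuous_fourier hσ hu))]

/-- An ultradistribution vanishes on the test functions that vanish on a large ball. -/
theorem exists_apply_eq_zero (hu : IsUltradistribution u) :
    ∃ R : ℝ, ∀ φ : testE d σ, (∀ x, ‖x‖ ≤ R → (φ : EuclideanSpace ℝ (Fin d) → ℂ) x = 0) →
      u φ = 0 := by
  obtain ⟨τ, -, K, hK, ε, -, C, -, hle⟩ := hu
  obtain ⟨B, hB⟩ := hK.exists_bound_of_continuousOn (f := id) continuousOn_id
  -- The margin 1 makes φ vanish in a neighbourhood of each point of K, so all its derivatives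
  -- vanish on K.
  refine ⟨B + 1, fun φ hφ => ?_⟩
  have hzero : ∀ (α : Fin d → ℕ), ∀ x ∈ K,
      diffD α (φ : EuclideanSpace ℝ (Fin d) → ℂ) x = 0 := by
    intro α x hx
    have hev : (φ : EuclideanSpace ℝ (Fin d) → ℂ) =ᶠ[𝓝 x] fun _ => 0 := by
      filter_upwards [Metric.ball_mem_nhds x one_pos] with y hy
      refine hφ y ?_
      have h1 := norm_le_norm_add_norm_sub' y x
      rw [Metric.mem_ball, dist_eq_norm] at hy
      have h2 : ‖x‖ ≤ B := hB x hx
      linarith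
    rw [diffD, partialD, (hev.iteratedFDeriv ℝ _).eq_of_nhds, iteratedFDeriv_fun_zero]
    simp
  have h := hle φ
  have h0 : (⨆ p : (Fin d → ℕ) × K, ‖diffD p.1 (φ : EuclideanSpace ℝ (Fin d) → ℂ) p.2‖ /
      (ε ^ ((len p.1 : ℝ) ^ σ) * M τ σ (len p.1))) = 0 := by
    simp only [fun p : (Fin d → ℕ) × K => hzero p.1 p.2 p.2.2, norm_zero, zero_div,
      Real.iSup_const_zero]
  rw [h0, mul_zero] at h
  exact norm_le_zero_iff.1 h

theorem apply_eq_apply_of_eqOn {R : ℝ}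
    (hR : ∀ φ : testE d σ, (∀ x, ‖x‖ ≤ R → (φ : EuclideanSpace ℝ (Fin d) → ℂ) x = 0) → u φ = 0)
    (φ ψ : testE d σ) (h : ∀ x, ‖x‖ ≤ R → (φ : EuclideanSpace ℝ (Fin d) → ℂ) x =
      (ψ : EuclideanSpace ℝ (Fin d) → ℂ) x) : u φ = u ψ := by
  rw [← sub_eq_zero, ← map_sub]
  refine hR _ fun x hx => ?_
  rw [Submodule.coe_sub, Pi.sub_apply, h x hx, sub_self]

theorem isRegular_of_rapidDecay (hσ : 1 < σ) (hu : IsUltradistribution u)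
    (hd : RapidDecay σ (fourier hσ u)) : IsRegular u := by
  set f := 𝓕⁻ (fourier hσ u) with hf
  have hfU : UltraDiff σ f := hd.ultraDiff_fourierInv hσ (continuous_fourier hσ hu)
  have hfmem : f ∈ testE d σ := (mem_testE_iff hσ).2 hfU
  obtain ⟨R, hR⟩ := exists_apply_eq_zero hu
  obtain ⟨χ, hχ, hχs, hχ1⟩ := exists_cutoff (d := d) hσ R
  have hχU := (mem_testE_iff hσ).1 hχ
  -- The representation formula so far covers only compactly supported test functions; this
  -- localization of f extends it to all of them.
  have hsupp : ∀ x, f x = f x * χ x := by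
    intro x
    -- θ makes (1 - χ)θ compactly supported without changing its value at x.
    obtain ⟨θ, hθ, hθs, hθ1⟩ := exists_cutoff (d := d) hσ ‖x‖
    have hθU := (mem_testE_iff hσ).1 hθ
    have hηU : UltraDiff σ fun y => (1 + (-1) * χ y) * θ y := by
      have h1 : (fun y => 1 + (-1) * χ y) ∈ testE d σ :=
        add_mem ((mem_testE_iff hσ).2 (UltraDiff.const hσ 1))
          ((mem_testE_iff hσ).2 ((UltraDiff.const hσ (-1)).mul hσ hχU))
      exact ((mem_testE_iff hσ).1 h1).mul hσ hθU
    have hηs : HasCompactSupport fun y => (1 + (-1) * χ y) * θ y := hθs.mul_left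
    set g : EuclideanSpace ℝ (Fin d) → ℂ := fun y => f y * ((1 + (-1) * χ y) * θ y) with hg
    have hgU : UltraDiff σ g := hfU.mul hσ hηU
    have hgs : HasCompactSupport g := hηs.mul_left
    -- The transform of g at ξ is u applied to (1 - χ) θ e_ξ, which vanishes on the ball that u
    -- sees. Fourier inversion then gives g = 0.
    have hF : 𝓕 g = fun _ => 0 := by
      funext ξ
      have hmem : (fun y => (1 + (-1) * χ y) * θ y * expo ξ y) ∈ testE d σ :=
        (mem_testE_iff hσ).2 (hηU.mul hσ ((mem_testE_iff hσ).1 (expo_mem_testE hσ ξ)))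
      have h1 := apply_eq_integral_of_hasCompactSupport hσ hu hd ⟨_, hmem⟩ hηs.mul_right
      rw [hR ⟨_, hmem⟩ fun y hy => by simp [hχ1 y hy]] at h1
      rw [fourier_eq_integral_expo, h1]
      refine integral_congr_ae (Eventually.of_forall fun y => ?_)
      simp only [hg, expo_symm y ξ, hf]
      ring
    have hgc : Continuous g := hgU.1.continuous
    have hinv := hgc.fourierInv_fourier_eq (hgc.integrable_of_hasCompactSupport hgs)
      (by rw [hF]; exact integrable_zero _ _ _)
    have hg0 : g x = 0 := by
      rw [← hinv, hF, Real.fourierInv_eq]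
      simp
    simp only [hg, hθ1 x le_rfl, mul_one] at hg0
    linear_combination hg0
  refine ⟨⟨f, hfmem⟩, fun φ => ?_⟩
  have hφU := (mem_testE_iff hσ).1 φ.2
  have hmem : (fun x => χ x * (φ : EuclideanSpace ℝ (Fin d) → ℂ) x) ∈ testE d σ :=
    (mem_testE_iff hσ).2 (hχU.mul hσ hφU)
  have hs : HasCompactSupport fun x => χ x * (φ : EuclideanSpace ℝ (Fin d) → ℂ) x := hχs.mul_right
  have heq : (fun x => f x * (φ : EuclideanSpace ℝ (Fin d) → ℂ) x) =
      fun x => f x * (χ x * (φ : EuclideanSpace ℝ (Fin d) → ℂ) x) := by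
    funext x
    rw [← mul_assoc, ← hsupp x]
  have h1 := apply_eq_integral_of_hasCompactSupport hσ hu hd ⟨_, hmem⟩ hs
  have h2 : u φ = u ⟨_, hmem⟩ := apply_eq_apply_of_eqOn hR _ _ fun x hx => by simp [hχ1 x hx]
  refine ⟨?_, ?_⟩
  · simp only [heq]
    refine Continuous.integrable_of_hasCompactSupport ?_ hs.mul_left
    exact hfU.1.continuous.mul (hχU.mul hσ hφU).1.continuous
  · rw [h2, h1]
    simp only [heq]
    rfl

end Regularity

end ExtGevrey

/-! ### The Paley–Wiener theorem -/

theorem theorem3p12 (d : ℕ) (σ : ℝ) (hσ : 1 < σ) (u : ExtGevrey.testE d σ →ₗ[ℂ] ℂ)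
    (hu : ExtGevrey.IsUltradistribution u) :
    (∃ h : ℝ, 0 < h ∧ ∃ C : ℝ, 0 < C ∧ ∃ R : ℝ, ∀ ξ : EuclideanSpace ℝ (Fin d), R ≤ ‖ξ‖ →
      ‖ExtGevrey.fourier hσ u ξ‖ ≤ C * Real.exp (h * ExtGevrey.rate σ ‖ξ‖)) ∧
    ((∀ h : ℝ, 0 < h → ∃ C : ℝ, 0 < C ∧ ∃ R : ℝ, ∀ ξ : EuclideanSpace ℝ (Fin d), R ≤ ‖ξ‖ →
      ‖ExtGevrey.fourier hσ u ξ‖ ≤ C * Real.exp (-h * ExtGevrey.rate σ ‖ξ‖)) →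
      ExtGevrey.IsRegular u) := by
  refine ⟨?_, fun hdecay => ?_⟩
  · obtain ⟨h, hh, C, hC, hle⟩ := ExtGevrey.exists_norm_fourier_le hσ hu
    exact ⟨h, hh, C, hC, 2, fun ξ hξ => hle ξ (by linarith)⟩
  · exact ExtGevrey.isRegular_of_rapidDecay hσ hu
      (ExtGevrey.rapidDecay_of_le_exp_neg_rate hσ (ExtGevrey.continuous_fourier hσ hu) hdecay)
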